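/- All Lie algebras are real and finite-dimensional. An endomorphism $A$ of a real vector space is called real if all its (complex) eigenvalues are real; we write $A>0$ (respectively $A\ge 0$) if all its (complex) eigenvalues are real and positive (respectively real and nonnegative). A derivation $\varphi$ of a Lie algebra $\mathfrak l$ is called pre-Einstein if it is real, semisimple, and $\operatorname{Tr}(\varphi\circ\psi)=\operatorname{Tr}\psi$ for every $\psi\in\operatorname{Der}(\mathfrak l)$; $\operatorname{ad}_\varphi$ denotes the map $\psi\mapsto[\varphi,\psi]$ on $\operatorname{Der}(\mathfrak l)$. An Einstein metric solvable Lie algebra is a solvable Lie algebra $\mathfrak g$ with an inner product $\langle\cdot,\cdot\rangle$ such that the Ricci tensor of the corresponding left-invariant Riemannian metric (computed on $\mathfrak g$) is a constant multiple of $\langle\cdot,\cdot\rangle$. The nilradical of $\mathfrak g$ is its largest nilpotent ideal. Theorem. Let $\mathfrak n$ be a nilpotent Lie algebra with a pre-Einstein derivation $\varphi$. Suppose that $\varphi>0$ and that $\operatorname{ad}_\varphi\ge 0$ on $\operatorname{Der}(\mathfrak n)$. Then every Einstein metric solvable Lie algebra $(\mathfrak g,\langle\cdot,\cdot\rangle)$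 whose nilradical is isomorphic to $\mathfrak n$ is standard, that is, the orthogonal complement of $[\mathfrak g,\mathfrak g]$ in $\mathfrak g$ is abelian. -/

import Mathlib

/-! ### Endomorphisms -/

/-- `A` is *real*: all eigenvalues of `A` (in `ℂ`, that is, of its complexification) are real. -/
def IsRealEnd {V : Type*} [AddCommGroup V] [Module ℝ V] (A : Module.End ℝ V) : Prop :=
  ∀ z : ℂ, Module.End.HasEigenvalue (LinearMap.baseChange ℂ A) z → ∃ r : ℝ, z = (r : ℂ)

/-- `A ≥ 0`: all eigenvalues of `A` (in `ℂ`) are real and nonnegative. -/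
def IsNonnegEnd {V : Type*} [AddCommGroup V] [Module ℝ V] (A : Module.End ℝ V) : Prop :=
  ∀ z : ℂ, Module.End.HasEigenvalue (LinearMap.baseChange ℂ A) z → ∃ r : ℝ, 0 ≤ r ∧ z = (r : ℂ)

/-- `A > 0`: all eigenvalues of `A` (in `ℂ`) are real and positive. -/
def IsPosEnd {V : Type*} [AddCommGroup V] [Module ℝ V] (A : Module.End ℝ V) : Prop :=
  ∀ z : ℂ, Module.End.HasEigenvalue (LinearMap.baseChange ℂ A) z → ∃ r : ℝ, 0 < r ∧ z = (r : ℂ)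

/-! ### Pre-Einstein derivations and the nilradical -/

/-- A derivation `φ` of a Lie algebra is *pre-Einstein* if it is real, semisimple and
`Tr (φ ∘ ψ) = Tr ψ` for every derivation `ψ`. -/
structure IsPreEinstein {L : Type*} [LieRing L] [LieAlgebra ℝ L]
    (φ : LieDerivation ℝ L L) : Prop where
  real : IsRealEnd φ.toLinearMap
  semisimple : Module.End.IsSemisimple φ.toLinearMap
  trace_comp : ∀ ψ : LieDerivation ℝ L L,
    LinearMap.trace ℝ L (φ.toLinearMap ∘ₗ ψ.toLinearMap) = LinearMap.trace ℝ L ψ.toLinearMap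

/-- `N` is the *nilradical* of `L`: the greatest ideal which is nilpotent as a Lie algebra.
(Mathlib's `LieAlgebra.maxNilpotentIdeal` is a different object: it only collects the ideals
on which the whole of `L` acts nilpotently.) -/
def IsNilradical {L : Type*} [LieRing L] [LieAlgebra ℝ L] (N : LieIdeal ℝ L) : Prop :=
  IsGreatest {I : LieIdeal ℝ L | LieRing.IsNilpotent I} N

/-! ### Inner products, the Levi-Civita connection and the Ricci tensor -/

/-- `ip` is an inner product (a symmetric positive definite bilinear form). -/
structure IsInnerProduct {V : Type*} [AddCommGroup V] [Module ℝ V]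
    (ip : LinearMap.BilinForm ℝ V) : Prop where
  symm : ∀ x y, ip x y = ip y x
  pos : ∀ x, x ≠ 0 → 0 < ip x x

/-- `D`, with `D X Y` standing for `∇_X Y`, is the Levi-Civita connection on left-invariant vector
fields of the left-invariant metric given by `ip`: it is torsion free and metric. -/
structure IsLeviCivita {L : Type*} [LieRing L] [LieAlgebra ℝ L]
    (ip : LinearMap.BilinForm ℝ L) (D : L →ₗ[ℝ] L →ₗ[ℝ] L) : Prop where
  torsion_free : ∀ X Y, D X Y - D Y X = ⁅X, Y⁆
  metric : ∀ X Y Z, ip (D X Y) Z + ip Y (D X Z) = 0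

/-- Levi-Civita connections exist and are unique. -/
theorem existsUnique_isLeviCivita {L : Type*} [LieRing L] [LieAlgebra ℝ L]
    [FiniteDimensional ℝ L] (ip : LinearMap.BilinForm ℝ L) (h : IsInnerProduct ip) :
    ∃! D : L →ₗ[ℝ] L →ₗ[ℝ] L, IsLeviCivita ip D := by
  have hinj : ∀ x y : L, (∀ z, ip x z = ip y z) → x = y := by
    intro x y hxy
    by_contra hne
    have h1 := h.pos (x - y) (sub_ne_zero.mpr hne)
    have h2 : ip (x - y) (x - y) = 0 := by
      rw [LinearMap.map_sub ip, LinearMap.sub_apply, hxy (x - y), sub_self]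
    exact absurd h2 h1.ne'
  have hker : LinearMap.ker ip = ⊥ := by
    rw [LinearMap.ker_eq_bot]
    intro x y hxy
    exact hinj x y fun z => by rw [hxy]
  let e : L ≃ₗ[ℝ] Module.Dual ℝ L :=
    LinearEquiv.ofInjectiveOfFinrankEq ip (LinearMap.ker_eq_bot.mp hker)
      (Subspace.dual_finrank_eq).symm
  have he : ∀ (f : Module.Dual ℝ L) (z : L), ip (e.symm f) z = f z := fun f z => by
    have : e (e.symm f) = f := e.apply_symm_apply f
    exact congrArg (fun g : Module.Dual ℝ L => g z) this
  -- the Koszul formula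
  let K : L → L → Module.Dual ℝ L := fun X Y =>
    (1 / 2 : ℝ) • (ip ⁅X, Y⁆ - (ip X) ∘ₗ (LieAlgebra.ad ℝ L Y)
      - (ip Y) ∘ₗ (LieAlgebra.ad ℝ L X))
  have hK : ∀ X Y Z, K X Y Z = (1 / 2 : ℝ) * (ip ⁅X, Y⁆ Z - ip X ⁅Y, Z⁆ - ip Y ⁅X, Z⁆) := by
    intro X Y Z
    simp [K]
  let D : L →ₗ[ℝ] L →ₗ[ℝ] L := LinearMap.mk₂ ℝ (fun X Y => e.symm (K X Y))
    (fun X X' Y => hinj _ _ fun Z => by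
      simp only [he, hK, map_add, LinearMap.add_apply, add_lie]; ring)
    (fun c X Y => hinj _ _ fun Z => by
      simp only [he, hK, map_smul, LinearMap.smul_apply, smul_lie, smul_eq_mul]; ring)
    (fun X Y Y' => hinj _ _ fun Z => by
      simp only [he, hK, map_add, LinearMap.add_apply, add_lie, lie_add]; ring)
    (fun c X Y => hinj _ _ fun Z => by
      simp only [he, hK, map_smul, LinearMap.smul_apply, smul_lie, lie_smul, smul_eq_mul]; ring)
  have hD : ∀ X Y Z, ip (D X Y) Z =
      (1 / 2 : ℝ) * (ip ⁅X, Y⁆ Z - ip X ⁅Y, Z⁆ - ip Y ⁅X, Z⁆) := fun X Y Z => by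
    simp only [D, LinearMap.mk₂_apply, he, hK]
  refine ⟨D, ⟨fun X Y => hinj _ _ fun Z => ?_, fun X Y Z => ?_⟩, ?_⟩
  · rw [map_sub, LinearMap.sub_apply, hD, hD, ← lie_skew X Y, map_neg, LinearMap.neg_apply]
    ring
  · rw [h.symm Y, hD, hD, ← lie_skew Z Y, h.symm ⁅X, Y⁆ Z, h.symm ⁅X, Z⁆ Y, map_neg]
    ring
  · intro D' h'
    have key : ∀ X Y Z, ip (D' X Y) Z =
        (1 / 2 : ℝ) * (ip ⁅X, Y⁆ Z - ip X ⁅Y, Z⁆ - ip Y ⁅X, Z⁆) := by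
      intro X Y Z
      rw [← h'.torsion_free X Y, ← h'.torsion_free Y Z, ← h'.torsion_free X Z]
      simp only [map_sub, LinearMap.sub_apply]
      have a := h'.metric X Y Z
      have b := h'.metric Y X Z
      have c := h'.metric Z X Y
      have d := h.symm (D' Z X) Y
      linarith
    refine LinearMap.ext fun X => LinearMap.ext fun Y => hinj _ _ fun Z => ?_
    rw [key, hD]

/-- The curvature operator `R(X, Y) Z = ∇_X ∇_Y Z - ∇_Y ∇_X Z - ∇_[X, Y] Z` of a connection on
left-invariant vector fields, as a linear map in `X`. -/
def curvature {L : Type*} [LieRing L] [LieAlgebra ℝ L]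
    (D : L →ₗ[ℝ] L →ₗ[ℝ] L) (Y Z : L) : L →ₗ[ℝ] L where
  toFun X := D X (D Y Z) - D Y (D X Z) - D ⁅X, Y⁆ Z
  map_add' X X' := by
    simp only [map_add, LinearMap.add_apply, add_lie]; abel
  map_smul' c X := by
    simp only [map_smul, LinearMap.smul_apply, smul_lie, RingHom.id_apply, smul_sub]

/-- The Ricci tensor `Ric(Y, Z) = Tr (X ↦ R(X, Y) Z)`. -/
noncomputable def ricciTensor {L : Type*} [LieRing L] [LieAlgebra ℝ L]
    (D : L →ₗ[ℝ] L →ₗ[ℝ] L) (Y Z : L) : ℝ :=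
  LinearMap.trace ℝ L (curvature D Y Z)

/-- The inner product `ip` on the Lie algebra `L` is *Einstein*: the Ricci tensor of its
Levi-Civita connection is a constant multiple of `ip`. -/
def IsEinstein {L : Type*} [LieRing L] [LieAlgebra ℝ L] (ip : LinearMap.BilinForm ℝ L) : Prop :=
  ∃ D : L →ₗ[ℝ] L →ₗ[ℝ] L, IsLeviCivita ip D ∧ ∃ c : ℝ, ∀ Y Z, ricciTensor D Y Z = c * ip Y Z

/-- The inner product `ip` is *standard*: the orthogonal complement to the derived algebra
`[L, L]` is abelian. -/
def IsStandard {L : Type*} [LieRing L] [LieAlgebra ℝ L] (ip : LinearMap.BilinForm ℝ L) : Prop :=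
  ∀ x ∈ ip.orthogonal (⁅(⊤ : LieIdeal ℝ L), (⊤ : LieIdeal ℝ L)⁆ : LieIdeal ℝ L).toSubmodule,
    ∀ y ∈ ip.orthogonal (⁅(⊤ : LieIdeal ℝ L), (⊤ : LieIdeal ℝ L)⁆ : LieIdeal ℝ L).toSubmodule,
      ⁅x, y⁆ = 0

/-!
An Einstein solvable Lie algebra whose nilradical `N` has a pre-Einstein derivation `φ > 0` with
`ad φ ≥ 0` is standard.

If `φ`, extended by zero to the orthogonal complement of `N`, were a symmetric operator `E`, one could
take the trace of the Einstein equation `Ric = c` against `E`. In general `φ` is not symmetric.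
However, `ad φ ≥ 0` means that all derivations of `N`, in particular the operators `ad x`, preserve the
decreasing filtration of `N` by the eigenvalues of `φ` (`LieDerivation.apply_mem_eigenGE`). So `φ` may
be replaced by the symmetric operator `E` with the same eigenvalues and the same filtration, which is
diagonal in an orthonormal basis obtained by the Gram-Schmidt process (`exists_isAdaptedBasis`). Then
the bracket has components of nonnegative weight only with respect to `E`, the trace of `E ^ 2` is
`Tr (φ ^ 2) = Tr φ`, and `Tr (E ∘ ad x) = Tr (φ ∘ ad x) = Tr (ad x)` by the pre-Einstein condition.

Write `Ric = R - B / 2 - S (ad H)`, with `H` the mean curvature vector, `B` the Killing form and `S`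
the symmetric part (`IsLeviCivita.einstein_eq_sum`). The Killing form vanishes on `N`. Hence the trace
against `E` gives `c Tr E = P - |H|²` with `P = Tr (R E) ≥ 0` (`IsAdaptedBasis.einstein_mul_sum`), and
the trace against `ad H` gives `Tr (S (ad H) ^ 2) = -c |H|²`, because `R` is orthogonal to derivations
(`IsLeviCivita.sum_symmAd_meanCurvature`).

* If `H ≠ 0`, the Cauchy-Schwarz inequality between `E` and `S (ad H)` yields `P ≤ 0`. So `P = 0`, which
  makes the orthogonal complement of `N` abelian, and `S (ad H)` is a positive multiple of `E`. As
  `ip ⁅H, x⁆ x = 0` for `x` orthogonal to the derived algebra, such an `x` is orthogonal to `N`.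
* If `H = 0`, the Einstein equation on a vector orthogonal to the derived algebra gives `c ≤ 0`, whence
  `P = c Tr E = 0`. If `Tr E = 0`, then `N = 0` and the algebra is abelian. Otherwise `c = 0`, and
  vectors of `N` orthogonal to the derived algebra are central.

That the derived algebra lies in the nilradical is a consequence of Lie's theorem over `ℂ`.
-/

/-! ### Diagonalizable endomorphisms -/

theorem LinearMap.apply_aeval_of_comp_eq {K V W : Type*} [Field K] [AddCommGroup V] [Module K V]
    [AddCommGroup W] [Module K W] {f : V →ₗ[K] W} {T : Module.End K V} {S : Module.End K W}
    (h : f ∘ₗ T = S ∘ₗ f) (p : Polynomial K) (x : V) :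
    f (Polynomial.aeval T p x) = Polynomial.aeval S p (f x) := by
  induction p using Polynomial.induction_on generalizing x with
  | C a => simp
  | add p q hp hq => simp [hp, hq]
  | monomial k a ih =>
    rw [pow_succ, ← mul_assoc, map_mul _ (_ * _), map_mul _ (_ * _), Module.End.mul_apply,
      Module.End.mul_apply, ih, Polynomial.aeval_X, Polynomial.aeval_X]
    exact congrArg _ (LinearMap.congr_fun h x)

open Module in
/-- A semisimple real endomorphism is diagonalizable over `ℝ`. -/
theorem IsRealEnd.iSup_eigenspace_eq_top {V : Type*} [AddCommGroup V] [Module ℝ V]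
    [FiniteDimensional ℝ V] {A : End ℝ V} (hr : IsRealEnd A) (hs : A.IsSemisimple) :
    ⨆ μ, A.eigenspace μ = ⊤ := by
  have hsplit : A.charpoly.Splits := by
    refine Polynomial.Splits.of_splits_map (algebraMap ℝ ℂ) (IsAlgClosed.splits _) fun z hz => ?_
    have hz' := Polynomial.isRoot_of_mem_roots hz
    rw [← LinearMap.charpoly_baseChange, ← End.hasEigenvalue_iff_isRoot_charpoly] at hz'
    obtain ⟨r, rfl⟩ := hr z hz'
    exact ⟨r, rfl⟩
  have hinv : ⨆ μ, A.eigenspace μ ∈ A.invtSubmodule := by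
    rw [End.mem_invtSubmodule]
    refine iSup_le fun μ x hx => ?_
    rw [Submodule.mem_comap, End.mem_eigenspace_iff.mp hx]
    exact Submodule.smul_mem _ _ (Submodule.mem_iSup_of_mem μ hx)
  obtain ⟨U, hU, hc⟩ := End.isSemisimple_iff.mp hs _ hinv
  suffices hbot : U = ⊥ by
    have := hc.sup_eq_top
    rwa [hbot, sup_bot_eq] at this
  by_contra hne
  have : Nontrivial U := Submodule.nontrivial_iff_ne_bot.mpr hne
  have hUm : ∀ x ∈ U, A x ∈ U := fun x hx => hU hx
  have hdvd : minpoly ℝ (A.restrict hUm) ∣ A.charpoly := by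
    refine minpoly.dvd _ _ (LinearMap.ext fun x => Subtype.ext ?_)
    have h := LinearMap.apply_aeval_of_comp_eq (f := U.subtype) (T := A.restrict hUm) (S := A) rfl
      A.charpoly x
    rwa [LinearMap.aeval_self_charpoly] at h
  obtain ⟨r, hr0⟩ := (hsplit.of_dvd A.charpoly_monic.ne_zero hdvd).exists_eval_eq_zero
    (minpoly.degree_pos (Algebra.IsIntegral.isIntegral _)).ne'
  obtain ⟨u, hu, hu0⟩ := (End.hasEigenvalue_of_isRoot hr0).exists_hasEigenvector
  refine hu0 (Subtype.ext ?_)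
  have hmem : (u : V) ∈ ⨆ μ, A.eigenspace μ := by
    refine Submodule.mem_iSup_of_mem r (End.mem_eigenspace_iff.mpr ?_)
    exact congrArg Subtype.val (End.mem_eigenspace_iff.mp hu)
  have := hc.disjoint.le_bot ⟨hmem, u.2⟩
  simpa using this

open Module in
/-- A real eigenvalue of `A` is an eigenvalue of its complexification. -/
theorem Module.End.HasEigenvalue.baseChange_complex {V : Type*} [AddCommGroup V] [Module ℝ V]
    [FiniteDimensional ℝ V] {A : End ℝ V} {r : ℝ} (h : A.HasEigenvalue r) :
    End.HasEigenvalue (LinearMap.baseChange ℂ A) (r : ℂ) := by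
  rw [End.hasEigenvalue_iff_isRoot_charpoly] at h ⊢
  rw [LinearMap.charpoly_baseChange]
  exact h.map (f := algebraMap ℝ ℂ)

open Module in
/-- The part of the filtration of `V` by the eigenvalues of `A` spanned by the eigenvectors with
eigenvalue at least `t`. -/
def eigenGE {V : Type*} [AddCommGroup V] [Module ℝ V] (A : End ℝ V) (t : ℝ) : Submodule ℝ V :=
  ⨆ μ : Set.Ici t, A.eigenspace (μ : ℝ)

open Module in
/-- The span of the eigenvectors of `A` with eigenvalue greater than `t`. -/
def eigenGT {V : Type*} [AddCommGroup V] [Module ℝ V] (A : End ℝ V) (t : ℝ) : Submodule ℝ V :=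
  ⨆ μ : Set.Ioi t, A.eigenspace (μ : ℝ)

section Filtration

open Module

variable {V : Type*} [AddCommGroup V] [Module ℝ V] {A : End ℝ V}

theorem mem_eigenGE {t μ : ℝ} (h : t ≤ μ) {x : V} (hx : A x = μ • x) : x ∈ eigenGE A t :=
  Submodule.mem_iSup_of_mem (⟨μ, h⟩ : Set.Ici t) (End.mem_eigenspace_iff.mpr hx)

theorem mem_eigenGT {t μ : ℝ} (h : t < μ) {x : V} (hx : A x = μ • x) : x ∈ eigenGT A t :=
  Submodule.mem_iSup_of_mem (⟨μ, h⟩ : Set.Ioi t) (End.mem_eigenspace_iff.mpr hx)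

theorem eigenGE_le {t : ℝ} {P : Submodule ℝ V} (h : ∀ μ, t ≤ μ → ∀ x, A x = μ • x → x ∈ P) :
    eigenGE A t ≤ P :=
  iSup_le fun μ x hx => h μ μ.2 x (End.mem_eigenspace_iff.mp hx)

theorem eigenGT_le {t : ℝ} {P : Submodule ℝ V} (h : ∀ μ, t < μ → ∀ x, A x = μ • x → x ∈ P) :
    eigenGT A t ≤ P :=
  iSup_le fun μ x hx => h μ μ.2 x (End.mem_eigenspace_iff.mp hx)

theorem eigenGE_anti {s t : ℝ} (h : s ≤ t) : eigenGE A t ≤ eigenGE A s :=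
  eigenGE_le fun _ hμ _ hx => mem_eigenGE (h.trans hμ) hx

theorem eigenGE_le_eigenGT {s t : ℝ} (h : s < t) : eigenGE A t ≤ eigenGT A s :=
  eigenGE_le fun _ hμ _ hx => mem_eigenGT (h.trans_le hμ) hx

theorem map_mem_eigenGT {t : ℝ} {x : V} (hx : x ∈ eigenGT A t) : A x ∈ eigenGT A t := by
  refine (eigenGT_le (P := (eigenGT A t).comap A) fun μ hμ x hx => ?_) hx
  rw [Submodule.mem_comap, hx]
  exact Submodule.smul_mem _ _ (mem_eigenGT hμ hx)

theorem map_sub_smul_mem_eigenGT {t : ℝ} {x : V} (hx : x ∈ eigenGE A t) :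
    A x - t • x ∈ eigenGT A t := by
  refine (eigenGE_le (P := (eigenGT A t).comap (A - t • LinearMap.id)) fun μ hμ x hx => ?_) hx
  rw [Submodule.mem_comap]
  simp only [LinearMap.sub_apply, LinearMap.smul_apply, LinearMap.id_coe, id_eq]
  rcases hμ.eq_or_lt with rfl | hlt
  · rw [hx, sub_self]
    exact Submodule.zero_mem _
  · rw [hx]
    exact Submodule.sub_mem _ (Submodule.smul_mem _ _ (mem_eigenGT hlt hx))
      (Submodule.smul_mem _ _ (mem_eigenGT hlt hx))

/-- A diagonalizable endomorphism has an eigenbasis, arranged by decreasing eigenvalues. -/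
theorem exists_eigenbasis_antitone [FiniteDimensional ℝ V] (hA : ⨆ μ, A.eigenspace μ = ⊤) :
    ∃ (v : Basis (Fin (finrank ℝ V)) ℝ V) (w : Fin (finrank ℝ V) → ℝ),
      Antitone w ∧ ∀ i, A (v i) = w i • v i := by
  have hspan : ⊤ ≤ Submodule.span ℝ {x : V | ∃ μ : ℝ, A x = μ • x} := by
    rw [← hA]
    exact iSup_le fun μ x hx => Submodule.subset_span ⟨μ, End.mem_eigenspace_iff.mp hx⟩
  let v₀ := Basis.ofSpan hspan
  let v₁ := v₀.reindex (v₀.indexEquiv (finBasis ℝ V))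
  have hv₁ : ∀ i, ∃ μ : ℝ, A (v₁ i) = μ • v₁ i := fun i => by
    rw [Basis.reindex_apply]
    exact Basis.ofSpan_subset hspan ⟨_, rfl⟩
  choose w hw using hv₁
  let σ := Tuple.sort fun i => -w i
  refine ⟨v₁.reindex σ.symm, w ∘ σ, fun i j hij => ?_, fun i => ?_⟩
  · exact neg_le_neg_iff.mp (Tuple.monotone_sort (fun i => -w i) hij)
  · simp [hw]

/-- Gram-Schmidt orthogonalization of an eigenbasis arranged by decreasing eigenvalues: an
orthonormal basis adapted to the filtration by the eigenvalues of `A`. -/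
theorem exists_orthonormal_adapted [FiniteDimensional ℝ V] (hA : ⨆ μ, A.eigenspace μ = ⊤)
    {ip : LinearMap.BilinForm ℝ V} (hip : IsInnerProduct ip) :
    ∃ (b : Basis (Fin (finrank ℝ V)) ℝ V) (w : Fin (finrank ℝ V) → ℝ),
      (∀ i j, ip (b i) (b j) = if i = j then 1 else 0) ∧
      (∀ i, A.HasEigenvalue (w i)) ∧
      (∀ i, b i ∈ eigenGE A (w i)) ∧
      ∀ i, ∀ x ∈ eigenGT A (w i), ip x (b i) = 0 := by
  obtain ⟨v, w, hw, hv⟩ := exists_eigenbasis_antitone hA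
  let core : InnerProductSpace.Core ℝ V :=
    { inner := fun x y => ip x y
      conj_inner_symm := fun x y => hip.symm y x
      re_inner_nonneg := fun x => by
        rcases eq_or_ne x 0 with rfl | h
        · simp
        · exact (hip.pos x h).le
      add_left := fun x y z => by simp
      smul_left := fun x y r => by simp
      definite := fun x h => by
        by_contra hx
        exact (hip.pos x hx).ne' h }
  let _ : NormedAddCommGroup V := core.toNormedAddCommGroup
  let _ : InnerProductSpace ℝ V := InnerProductSpace.ofCore core.toCore
  have hinner : ∀ x y : V, inner ℝ x y = ip x y := fun _ _ => rfl
  have hne : ∀ i, InnerProductSpace.gramSchmidtNormed ℝ v i ≠ 0 := fun i h => by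
    have := InnerProductSpace.gramSchmidtNormed_unit_length (𝕜 := ℝ) i v.linearIndependent
    rw [h, norm_zero] at this
    exact zero_ne_one this
  let b := InnerProductSpace.gramSchmidtOrthonormalBasis (𝕜 := ℝ) (by simp) v
  have hb : ∀ i, b i ∈ Submodule.span ℝ (v '' Set.Iic i) := fun i => by
    rw [InnerProductSpace.gramSchmidtOrthonormalBasis_apply _ (hne i)]
    exact Submodule.smul_mem _ _ (InnerProductSpace.gramSchmidt_mem_span ℝ v le_rfl)
  refine ⟨b.toBasis, w, fun i j => ?_, fun i => ?_, fun i => ?_, fun i x hx => ?_⟩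
  · rw [← hinner]
    simpa using orthonormal_iff_ite.mp b.orthonormal i j
  · exact End.hasEigenvalue_of_hasEigenvector
      ⟨End.mem_eigenspace_iff.mpr (hv i), v.ne_zero i⟩
  · rw [OrthonormalBasis.coe_toBasis]
    refine Submodule.span_le.mpr ?_ (hb i)
    rintro _ ⟨j, hj, rfl⟩
    exact mem_eigenGE (hw hj) (hv j)
  · rw [OrthonormalBasis.coe_toBasis]
    refine (eigenGT_le (P := LinearMap.ker (ip.flip (b i))) fun μ hμ x hx => ?_) hx
    rw [LinearMap.mem_ker]
    change ip x (b i) = 0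
    rw [← v.sum_repr x, map_sum, LinearMap.sum_apply]
    refine Finset.sum_eq_zero fun j _ => ?_
    rw [map_smul, LinearMap.smul_apply, smul_eq_mul]
    -- only the basis vectors with eigenvalue `μ` contribute to `x`
    by_cases hj : w j = μ
    · have hji : j < i := by
        by_contra hle
        exact absurd (hw (not_lt.mp hle)) (not_le.mpr (hj ▸ hμ))
      rw [hip.symm, ← hinner,
        InnerProductSpace.gramSchmidtOrthonormalBasis_inv_triangular _ _ hji, mul_zero]
    · have h1 : v.repr (A x) j = w j * v.repr x j := by
        have h2 : A x = ∑ l, (w l * v.repr x l) • v l := by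
          conv_lhs => rw [← v.sum_repr x, map_sum]
          exact Finset.sum_congr rfl fun l _ => by rw [map_smul, hv, smul_smul, mul_comm]
        rw [h2, v.repr_sum_self]
      rw [hx, map_smul, Finsupp.smul_apply, smul_eq_mul] at h1
      have h2 : (w j - μ) * v.repr x j = 0 := by rw [sub_mul, h1, sub_self]
      rw [(mul_eq_zero.mp h2).resolve_left (sub_ne_zero.mpr hj), zero_mul]

end Filtration

/-! ### Nilpotency in solvable Lie algebras -/

section Nilpotency

open TensorProduct

/-- Over an algebraically closed field of characteristic zero, the derived algebra of a solvable
Lie algebra acts by nilpotent endomorphisms: split off common eigenvectors one at a time. -/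
theorem LieModule.isNilpotent_toEnd_of_mem_derivedSeries {k L : Type*} [Field k] [IsAlgClosed k]
    [CharZero k] [LieRing L] [LieAlgebra k L] [LieAlgebra.IsSolvable L] {x : L}
    (hx : x ∈ LieAlgebra.derivedSeries k L 1) :
    ∀ (d : ℕ) (V : Type*) [AddCommGroup V] [Module k V] [FiniteDimensional k V]
      [LieRingModule L V] [LieModule k L V], Module.finrank k V = d →
      _root_.IsNilpotent (LieModule.toEnd k L V x) := by
  intro d
  induction d using Nat.strong_induction_on with
  | _ d ih =>
  intro V _ _ _ _ _ hd
  rcases subsingleton_or_nontrivial V with hV | hV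
  · exact ⟨1, Subsingleton.elim _ _⟩
  obtain ⟨χ, hχ⟩ := LieModule.exists_nontrivial_weightSpace_of_isSolvable k L V
  obtain ⟨⟨v, hv⟩, hv0⟩ := exists_ne (0 : LieModule.weightSpace V χ)
  have hv0 : v ≠ 0 := fun h => hv0 (Subtype.ext h)
  rw [LieModule.mem_weightSpace] at hv
  let N : LieSubmodule k L V :=
    { Submodule.span k {v} with
      lie_mem := fun {y m} hm => by
        obtain ⟨a, rfl⟩ := Submodule.mem_span_singleton.mp hm
        rw [lie_smul, hv, smul_smul]
        exact Submodule.mem_span_singleton.mpr ⟨_, rfl⟩ }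
  have hN : ∀ m ∈ N, ⁅x, m⁆ = 0 := by
    intro m hm
    obtain ⟨a, rfl⟩ := Submodule.mem_span_singleton.mp hm
    have hχx : χ x = 0 := by
      have hx' : x ∈ Submodule.span k {⁅u, v⁆ | (u : L) (v : L)} := by
        rw [← LieAlgebra.coe_derivedSeries_one_eq]; exact hx
      refine (Submodule.span_le (p := LinearMap.ker χ)).mpr ?_ hx'
      rintro _ ⟨a, b, rfl⟩
      have h := hv ⁅a, b⁆
      rw [lie_lie, hv a, hv b, lie_smul, lie_smul, hv a, hv b, smul_smul, smul_smul,
        mul_comm, sub_self] at h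
      exact (smul_eq_zero.mp h.symm).resolve_right hv0
    rw [lie_smul, hv, hχx, zero_smul, smul_zero]
  have hlt : Module.finrank k (V ⧸ N) < d := by
    rw [← hd]
    have h1 := Submodule.finrank_quotient_add_finrank (N : Submodule k V)
    have h2 : Module.finrank k (N : Submodule k V) = 1 := finrank_span_singleton hv0
    change Module.finrank k (V ⧸ (N : Submodule k V)) < _
    omega
  obtain ⟨j, hj⟩ := ih _ hlt (V ⧸ N) rfl
  refine ⟨j + 1, LinearMap.ext fun m => ?_⟩
  have key : ∀ i : ℕ, ((LieModule.toEnd k L (V ⧸ N) x) ^ i) (LieSubmodule.Quotient.mk m)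
      = LieSubmodule.Quotient.mk (((LieModule.toEnd k L V x) ^ i) m) := by
    intro i
    induction i with
    | zero => rfl
    | succ i hi => rw [pow_succ', pow_succ', Module.End.mul_apply, hi]; rfl
  have h := key j
  rw [hj, LinearMap.zero_apply] at h
  rw [pow_succ', Module.End.mul_apply, LieModule.toEnd_apply_apply]
  exact hN _ ((LieSubmodule.Quotient.mk_eq_zero (N := N)).mp h.symm)

/-- The derived algebra of a solvable Lie algebra is a nilpotent ideal. -/
theorem LieAlgebra.isNilpotent_derivedSeries_one {L : Type*} [LieRing L] [LieAlgebra ℝ L]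
    [FiniteDimensional ℝ L] [LieAlgebra.IsSolvable L] :
    LieRing.IsNilpotent (LieAlgebra.derivedSeries ℝ L 1) := by
  rw [LieAlgebra.isNilpotent_iff_forall (R := ℝ)]
  rintro ⟨x, hx⟩
  refine LieSubalgebra.isNilpotent_ad_of_isNilpotent_ad
    (LieAlgebra.derivedSeries ℝ L 1 : LieSubalgebra ℝ L) (x := ⟨x, hx⟩) ?_
  have hx' : (1 : ℂ) ⊗ₜ[ℝ] x ∈ LieAlgebra.derivedSeries ℂ (ℂ ⊗[ℝ] L) 1 := by
    rw [LieAlgebra.derivedSeries_baseChange]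
    exact Submodule.tmul_mem_baseChange_of_mem 1 hx
  have hnil := LieModule.isNilpotent_toEnd_of_mem_derivedSeries hx' _ (ℂ ⊗[ℝ] L) rfl
  rw [LieModule.toEnd_baseChange] at hnil
  exact (IsNilpotent.map_iff (LinearMap.baseChangeHom_injective ℝ L ℂ)
    (f := Module.End.baseChangeHom ℝ ℂ L)).mp hnil

/-- If `y` lies in a nilpotent ideal, then `y` is orthogonal to everything for the Killing form. -/
theorem LieIdeal.trace_ad_comp_ad_eq_zero {L : Type*} [LieRing L] [LieAlgebra ℝ L]
    [FiniteDimensional ℝ L] (N : LieIdeal ℝ L) [LieRing.IsNilpotent N] (x : L) {y : L}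
    (hy : y ∈ N) :
    LinearMap.trace ℝ L (LieAlgebra.ad ℝ L x ∘ₗ LieAlgebra.ad ℝ L y) = 0 := by
  have hnil : LieModule.IsNilpotent N L := by
    rw [LieModule.isNilpotent_iff_forall' (R := ℝ)]
    intro z
    obtain ⟨k, hk⟩ := LieAlgebra.isNilpotent_iff_forall (R := ℝ).mp ‹LieRing.IsNilpotent N› z
    refine ⟨k + 1, LinearMap.ext fun m => ?_⟩
    have key : ∀ i (u : N), ((LieModule.toEnd ℝ N L z) ^ i) (u : L)
        = (((LieAlgebra.ad ℝ N z) ^ i) u : N) := by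
      intro i u
      induction i with
      | zero => rfl
      | succ i hi => rw [pow_succ', pow_succ', Module.End.mul_apply, hi]; rfl
    rw [pow_succ, Module.End.mul_apply]
    have h := key k ⟨⁅(z : L), m⁆, lie_mem_left ℝ L N _ _ z.2⟩
    rw [hk] at h
    exact h
  obtain ⟨k, hk⟩ := LieModule.IsNilpotent.nilpotent ℝ N L
  refine (LinearMap.isNilpotent_trace_of_isNilpotent ⟨k, LinearMap.ext fun m => ?_⟩).eq_zero
  have key : ∀ i, ((LieAlgebra.ad ℝ L x ∘ₗ LieAlgebra.ad ℝ L y) ^ i) m ∈ N.lcs L i := by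
    intro i
    induction i with
    | zero => simp
    | succ i hi =>
      rw [pow_succ', Module.End.mul_apply, LieIdeal.lcs_succ]
      exact LieSubmodule.lie_mem _ (LieSubmodule.lie_mem_lie hy hi)
  have h := key k
  rw [← LieSubmodule.mem_toSubmodule, LieIdeal.coe_lcs_eq, hk] at h
  simpa using h

end Nilpotency

/-! ### A basis adapted to the inner product and to the derivation -/

section Orthonormal

open Module

variable {V ι : Type*} [AddCommGroup V] [Module ℝ V] [Fintype ι] [DecidableEq ι]
  {ip : LinearMap.BilinForm ℝ V} {b : Basis ι ℝ V}

theorem repr_eq_of_orthonormal (hb : ∀ i j, ip (b i) (b j) = if i = j then 1 else 0)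
    (x : V) (i : ι) : b.repr x i = ip x (b i) := by
  conv_rhs => rw [← b.sum_repr x, map_sum, LinearMap.sum_apply]
  simp only [map_smul, LinearMap.smul_apply, hb, smul_eq_mul, mul_ite, mul_one, mul_zero,
    Finset.sum_ite_eq', Finset.mem_univ, if_true]

theorem sum_smul_of_orthonormal (hb : ∀ i j, ip (b i) (b j) = if i = j then 1 else 0)
    (x : V) : ∑ i, ip x (b i) • b i = x := by
  conv_rhs => rw [← b.sum_repr x]
  simp only [repr_eq_of_orthonormal hb]

theorem sum_mul_of_orthonormal (hb : ∀ i j, ip (b i) (b j) = if i = j then 1 else 0)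
    (x y : V) : ∑ i, ip x (b i) * ip y (b i) = ip x y := by
  conv_rhs => rw [← sum_smul_of_orthonormal hb y]
  simp only [map_sum, map_smul, smul_eq_mul, mul_comm]

theorem trace_of_orthonormal (hb : ∀ i j, ip (b i) (b j) = if i = j then 1 else 0)
    (T : End ℝ V) : LinearMap.trace ℝ V T = ∑ i, ip (T (b i)) (b i) := by
  rw [LinearMap.trace_eq_matrix_trace ℝ b, Matrix.trace]
  refine Finset.sum_congr rfl fun i _ => ?_
  rw [Matrix.diag_apply, LinearMap.toMatrix_apply, repr_eq_of_orthonormal hb]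

theorem trace_comp_of_orthonormal [FiniteDimensional ℝ V]
    (hb : ∀ i j, ip (b i) (b j) = if i = j then 1 else 0) (T S : End ℝ V) :
    LinearMap.trace ℝ V (T ∘ₗ S) = ∑ i, ∑ j, ip (T (b i)) (b j) * ip (S (b j)) (b i) := by
  rw [LinearMap.trace_comp_comm', trace_of_orthonormal hb]
  refine Finset.sum_congr rfl fun i _ => ?_
  conv_lhs => rw [LinearMap.comp_apply, ← sum_smul_of_orthonormal hb (T (b i))]
  simp only [map_sum, map_smul, LinearMap.sum_apply, LinearMap.smul_apply, smul_eq_mul]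

end Orthonormal

/-- An orthonormal basis `b` of a metric Lie algebra, with nonnegative weights `w`, *adapted* to an
ideal `N`. The weights stand for the eigenvalues of a symmetric operator `E` with `E b i = w i • b i`
which imitates the pre-Einstein derivation of `N`: the Lie bracket has components of nonnegative
weight only, `E` vanishes off `N`, and the traces of `E ^ 2` and `ad x ∘ E` are those
that the pre-Einstein condition prescribes. -/
structure IsAdaptedBasis {L ι : Type*} [LieRing L] [LieAlgebra ℝ L] [Fintype ι] [DecidableEq ι]
    (ip : LinearMap.BilinForm ℝ L) (N : LieIdeal ℝ L) (b : Module.Basis ι ℝ L) (w : ι → ℝ) :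
    Prop where
  orthonormal : ∀ i j, ip (b i) (b j) = if i = j then 1 else 0
  nonneg : ∀ i, 0 ≤ w i
  mem_of_pos : ∀ i, 0 < w i → b i ∈ N
  add_le : ∀ i j k, ip ⁅b i, b j⁆ (b k) ≠ 0 → w i + w j ≤ w k
  lie_of_eq_zero : ∀ (x y : L) k, w k = 0 → ip ⁅x, y⁆ (b k) = 0
  sum_sq : ∑ i, w i ^ 2 = ∑ i, w i
  sum_ad : ∀ x : L, ∑ i, w i * ip ⁅x, b i⁆ (b i) = LinearMap.trace ℝ L (LieAlgebra.ad ℝ L x)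

/-- If `φ` is semisimple and `ad φ ≥ 0` on derivations, then every derivation preserves the
filtration by the eigenvalues of `φ`: each component of weight `δ < 0` would be an eigenvector
of `ad φ`. -/
theorem LieDerivation.apply_mem_eigenGE {n : Type*} [LieRing n] [LieAlgebra ℝ n]
    [FiniteDimensional ℝ n] {φ : LieDerivation ℝ n n}
    (hs : Module.End.IsSemisimple φ.toLinearMap)
    (had : IsNonnegEnd (LieAlgebra.ad ℝ (LieDerivation ℝ n n) φ))
    (ψ : LieDerivation ℝ n n) {μ : ℝ} {u : n} (hu : φ u = μ • u) :
    ψ u ∈ eigenGE φ.toLinearMap μ := by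
  have : FiniteDimensional ℝ (LieDerivation ℝ n n) := inferInstance
  have hss : (LieAlgebra.ad ℝ (LieDerivation ℝ n n) φ).IsSemisimple := by
    have had' := LieAlgebra.ad_isSemisimple_of_isSemisimple hs
    rw [LieAlgebra.ad_eq_lmul_left_sub_lmul_right] at had'
    let F : LieDerivation ℝ n n →ₗ[ℝ] Module.End ℝ n :=
      { toFun := fun ψ => ψ.toLinearMap
        map_add' := fun _ _ => rfl
        map_smul' := fun _ _ => rfl }
    have hF : F ∘ₗ LieAlgebra.ad ℝ (LieDerivation ℝ n n) φ =
        (LinearMap.mulLeft ℝ φ.toLinearMap - LinearMap.mulRight ℝ φ.toLinearMap) ∘ₗ F :=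
      LinearMap.ext fun _ => rfl
    refine Module.End.isSemisimple_of_squarefree_aeval_eq_zero had'.minpoly_squarefree
      (LinearMap.ext fun ψ => LieDerivation.ext fun u => LinearMap.congr_fun
        ((LinearMap.apply_aeval_of_comp_eq hF _ ψ).trans ?_) u)
    exact LinearMap.congr_fun (minpoly.aeval ℝ (LinearMap.mulLeft ℝ φ.toLinearMap -
      LinearMap.mulRight ℝ φ.toLinearMap)) (F ψ)
  have htop := IsRealEnd.iSup_eigenspace_eq_top
    (fun z hz => let ⟨r, _, hr⟩ := had z hz; ⟨r, hr⟩) hss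
  have hψ : ψ ∈ ⨆ δ, (LieAlgebra.ad ℝ (LieDerivation ℝ n n) φ).eigenspace δ :=
    htop ▸ Submodule.mem_top
  refine Submodule.iSup_induction _ (motive := fun ψ : LieDerivation ℝ n n =>
    ψ u ∈ eigenGE φ.toLinearMap μ) hψ (fun δ ψ hψ => ?_) ?_ fun ψ ψ' h h' => ?_
  · rcases eq_or_ne ψ 0 with rfl | hne
    · exact Submodule.zero_mem _
    obtain ⟨r, hr, hδ⟩ := had _ (Module.End.hasEigenvalue_of_hasEigenvector
      ⟨hψ, hne⟩).baseChange_complex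
    obtain rfl : δ = r := by exact_mod_cast hδ
    refine mem_eigenGE (le_add_of_nonneg_right hr) ?_
    have h := congrArg (fun D : LieDerivation ℝ n n => D u) (Module.End.mem_eigenspace_iff.mp hψ)
    simp only [LieAlgebra.ad_apply, LieDerivation.commutator_apply, hu, map_smul,
      LieDerivation.smul_apply] at h
    change φ (ψ u) = _
    rw [add_smul, ← h]
    abel
  · exact Submodule.zero_mem _
  · exact Submodule.add_mem _ h h'

section Adapted

open Module

variable {n : Type*} [LieRing n] [LieAlgebra ℝ n] {g : Type*} [LieRing g] [LieAlgebra ℝ g]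

/-- The derivation of an ideal (in the guise of an isomorphic Lie algebra `n`) induced by `ad x`. -/
theorem exists_lieDerivation_of_ideal (N : LieIdeal ℝ g) (e : n ≃ₗ⁅ℝ⁆ N) (x : g) :
    ∃ ψ : LieDerivation ℝ n n, ∀ u, (e (ψ u) : g) = ⁅x, (e u : g)⁆ := by
  let f : n →ₗ[ℝ] n :=
    { toFun := fun u => e.symm ⟨⁅x, (e u : g)⁆, lie_mem_right ℝ g N x _ (e u).2⟩
      map_add' := fun u v => e.injective (Subtype.ext (by simp))
      map_smul' := fun c u => e.injective (Subtype.ext (by simp)) }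
  have hf : ∀ u, (e (f u) : g) = ⁅x, (e u : g)⁆ := fun u => by simp [f]
  refine ⟨⟨f, fun u v => e.injective (Subtype.ext ?_)⟩, hf⟩
  have h1 : ∀ u v : n, (e ⁅u, v⁆ : g) = ⁅(e u : g), (e v : g)⁆ := fun u v => by
    rw [LieEquiv.map_lie]; rfl
  change (e (f ⁅u, v⁆) : g) = (e (⁅u, f v⁆ - ⁅v, f u⁆) : g)
  rw [hf, map_sub]
  change _ = (e ⁅u, f v⁆ : g) - (e ⁅v, f u⁆ : g)
  rw [h1, h1, h1, hf, hf, leibniz_lie, ← lie_skew ⁅x, (e u : g)⁆]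
  abel

variable {ip : LinearMap.BilinForm ℝ g} {N : LieIdeal ℝ g}

/-- A positive pre-Einstein derivation of the nilradical with `ad φ ≥ 0`, extended by zero, gives an
adapted basis by Gram-Schmidt orthogonalization of an eigenbasis. This does not change the filtration
by the eigenvalues, which the operators `ad x` preserve, nor the traces, which only depend on
the action on the associated graded space. -/
theorem exists_isAdaptedBasis [FiniteDimensional ℝ n] [FiniteDimensional ℝ g]
    {φ : LieDerivation ℝ n n} (hφ : IsPreEinstein φ)
    (hpos : IsPosEnd φ.toLinearMap)
    (had : IsNonnegEnd (LieAlgebra.ad ℝ (LieDerivation ℝ n n) φ))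
    (e : n ≃ₗ⁅ℝ⁆ N) (hN : ∀ x y : g, ⁅x, y⁆ ∈ N) (hip : IsInnerProduct ip) :
    ∃ (b : Basis (Fin (finrank ℝ g)) ℝ g) (w : Fin (finrank ℝ g) → ℝ),
      IsAdaptedBasis ip N b w := by
  obtain ⟨ι, hι⟩ : ∃ ι : n →ₗ[ℝ] g, ∀ u, ι u = (e u : g) :=
    ⟨N.toSubmodule.subtype ∘ₗ (e : n →ₗ[ℝ] N), fun _ => rfl⟩
  have hιinj : Function.Injective ι := fun u v h =>
    e.injective (Subtype.ext ((hι u).symm.trans (h.trans (hι v))))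
  have hιN : ∀ u, ι u ∈ N := fun u => hι u ▸ (e u).2
  have hιsurj : ∀ x ∈ N, ∃ u, ι u = x := fun x hx => ⟨e.symm ⟨x, hx⟩, by simp [hι]⟩
  have hιlie : ∀ u v, ι ⁅u, v⁆ = ⁅ι u, ι v⁆ := fun u v => by
    rw [hι, hι, hι, LieEquiv.map_lie]; rfl
  -- `A` is the extension of `φ` by zero along some complement of the nilradical
  obtain ⟨π, hπ⟩ := LinearMap.exists_leftInverse_of_injective ι (LinearMap.ker_eq_bot.mpr hιinj)
  have hπι : ∀ u, π (ι u) = u := fun u => LinearMap.congr_fun hπ u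
  let A : End ℝ g := ι ∘ₗ φ.toLinearMap ∘ₗ π
  have hAι : ∀ u, A (ι u) = ι (φ u) := fun u => by
    change ι (φ (π (ι u))) = _
    rw [hπι]
  have hlift : ∀ (μ : ℝ), μ ≠ 0 → ∀ x, A x = μ • x → ∃ u, ι u = x ∧ φ u = μ • u := by
    intro μ hμ x hx
    have hxN : x ∈ N := by
      have h : x = μ⁻¹ • A x := by rw [hx, smul_smul, inv_mul_cancel₀ hμ, one_smul]
      rw [h]
      exact N.smul_mem _ (hιN _)
    obtain ⟨u, rfl⟩ := hιsurj x hxN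
    exact ⟨u, rfl, hιinj (by rw [← hAι, hx, map_smul])⟩
  have hφpos : ∀ (μ : ℝ) (u : n), u ≠ 0 → φ u = μ • u → 0 < μ := by
    intro μ u hu h
    obtain ⟨r, hr, h'⟩ := hpos _ (End.hasEigenvalue_of_hasEigenvector
      ⟨End.mem_eigenspace_iff.mpr h, hu⟩).baseChange_complex
    obtain rfl : μ = r := by exact_mod_cast h'
    exact hr
  have hnonneg : ∀ (μ : ℝ) (x : g), x ≠ 0 → A x = μ • x → 0 ≤ μ := by
    intro μ x hx h
    rcases eq_or_ne μ 0 with rfl | hμ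
    · exact le_rfl
    obtain ⟨u, rfl, hu⟩ := hlift μ hμ x h
    exact (hφpos μ u (fun h0 => hx (by rw [h0, map_zero])) hu).le
  have hφtop := hφ.real.iSup_eigenspace_eq_top hφ.semisimple
  -- the nilradical is spanned by the eigenvectors of positive eigenvalue
  have hNGT : ∀ x ∈ N, x ∈ eigenGT A 0 := by
    intro x hx
    obtain ⟨u, rfl⟩ := hιsurj x hx
    have h : (⊤ : Submodule ℝ n) ≤ (eigenGT A 0).comap ι := by
      rw [← hφtop]
      refine iSup_le fun μ v hv => ?_
      have hv' : φ v = μ • v := End.mem_eigenspace_iff.mp hv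
      rw [Submodule.mem_comap]
      rcases eq_or_ne v 0 with rfl | h0
      · rw [map_zero]; exact Submodule.zero_mem _
      · exact mem_eigenGT (hφpos μ v h0 hv') (by rw [hAι, hv', map_smul])
    exact h (Submodule.mem_top (x := u))
  have hGE0 : ∀ x, x ∈ eigenGE A 0 := by
    intro x
    have h1 : ι (π x) ∈ eigenGE A 0 :=
      (eigenGT_le fun _ hμ _ hx => mem_eigenGE hμ.le hx) (hNGT _ (hιN _))
    have h2 : x - ι (π x) ∈ eigenGE A 0 := by
      refine mem_eigenGE le_rfl ?_
      change ι (φ (π (x - ι (π x)))) = _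
      rw [map_sub, hπι, sub_self, map_zero, map_zero, zero_smul]
    simpa using Submodule.add_mem _ h1 h2
  have htop : ⨆ μ, A.eigenspace μ = ⊤ :=
    eq_top_iff.mpr fun x _ => eigenGE_le (fun μ _ y hy =>
      Submodule.mem_iSup_of_mem μ (End.mem_eigenspace_iff.mpr hy)) (hGE0 x)
  have had_eig : ∀ (x : g) (μ : ℝ), 0 < μ → ∀ y, A y = μ • y → ⁅x, y⁆ ∈ eigenGE A μ := by
    intro x μ hμ y hy
    obtain ⟨u, rfl, hu⟩ := hlift μ hμ.ne' y hy
    obtain ⟨ψ, hψ⟩ := exists_lieDerivation_of_ideal N e x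
    rw [hι, ← hψ, ← hι]
    have h : eigenGE φ.toLinearMap μ ≤ (eigenGE A μ).comap ι :=
      eigenGE_le fun ν hν v (hv : φ v = ν • v) => mem_eigenGE hν (by rw [hAι, hv, map_smul])
    exact h (LieDerivation.apply_mem_eigenGE hφ.semisimple had ψ hu)
  have had_GT : ∀ (x : g) (t : ℝ), 0 ≤ t → ∀ y ∈ eigenGT A t, ⁅x, y⁆ ∈ eigenGT A t := by
    intro x t ht y hy
    refine (eigenGT_le (P := (eigenGT A t).comap (LieAlgebra.ad ℝ g x))
      fun μ hμ z hz => ?_) hy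
    exact eigenGE_le_eigenGT hμ (had_eig x μ (ht.trans_lt hμ) z hz)
  have hlie_eig : ∀ μ ν x y, A x = μ • x → A y = ν • y → ⁅x, y⁆ ∈ eigenGE A (μ + ν) := by
    intro μ ν x y hx hy
    rcases eq_or_ne x 0 with rfl | hx0
    · rw [zero_lie]; exact Submodule.zero_mem _
    rcases eq_or_ne y 0 with rfl | hy0
    · rw [lie_zero]; exact Submodule.zero_mem _
    rcases (hnonneg μ x hx0 hx).eq_or_lt with rfl | hμ
    · rcases (hnonneg ν y hy0 hy).eq_or_lt with rfl | hν
      · rw [add_zero]; exact hGE0 _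
      · rw [zero_add]; exact had_eig x ν hν y hy
    rcases (hnonneg ν y hy0 hy).eq_or_lt with rfl | hν
    · rw [add_zero, ← lie_skew]
      exact Submodule.neg_mem _ (had_eig y μ hμ x hx)
    obtain ⟨u, rfl, hu⟩ := hlift μ hμ.ne' x hx
    obtain ⟨v, rfl, hv⟩ := hlift ν hν.ne' y hy
    refine mem_eigenGE le_rfl ?_
    rw [← hιlie, hAι, LieDerivation.apply_lie_eq_add, hu, hv, lie_smul, smul_lie, ← add_smul,
      map_smul, add_comm]
  have hlie : ∀ s t x y, x ∈ eigenGE A s → y ∈ eigenGE A t → ⁅x, y⁆ ∈ eigenGE A (s + t) := by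
    intro s t x y hx hy
    refine (eigenGE_le (P := (eigenGE A (s + t)).comap (LieAlgebra.ad ℝ g x))
      fun ν hν y hy => ?_) hy
    rw [Submodule.mem_comap]
    change ⁅x, y⁆ ∈ _
    rw [← lie_skew]
    refine Submodule.neg_mem _ ?_
    refine (eigenGE_le (P := (eigenGE A (s + t)).comap (LieAlgebra.ad ℝ g y))
      fun μ hμ x hx => ?_) hx
    rw [Submodule.mem_comap]
    exact eigenGE_anti (by linarith) (hlie_eig ν μ y x hy hx)
  obtain ⟨b, w, hb, hwA, hbw, horth⟩ := exists_orthonormal_adapted htop hip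
  have htr : ∀ T : End ℝ n, LinearMap.trace ℝ g (ι ∘ₗ T ∘ₗ π) = LinearMap.trace ℝ n T :=
      fun T => by
    rw [LinearMap.trace_comp_comm', LinearMap.comp_assoc, hπ, LinearMap.comp_id]
  have hw0 : ∀ i, 0 ≤ w i := fun i => by
    obtain ⟨x, hx, hx0⟩ := (hwA i).exists_hasEigenvector
    exact hnonneg _ x hx0 (End.mem_eigenspace_iff.mp hx)
  have hAb : ∀ i, A (b i) - w i • b i ∈ eigenGT A (w i) := fun i =>
    map_sub_smul_mem_eigenGT (hbw i)
  have htrA : LinearMap.trace ℝ g A = ∑ i, w i := by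
    rw [trace_of_orthonormal hb]
    refine Finset.sum_congr rfl fun i _ => ?_
    have h := horth i _ (hAb i)
    rw [map_sub, LinearMap.sub_apply, map_smul, LinearMap.smul_apply, hb, if_pos rfl] at h
    simpa [sub_eq_zero] using h
  have htrAA : LinearMap.trace ℝ g (A ∘ₗ A) = ∑ i, w i ^ 2 := by
    rw [trace_of_orthonormal hb]
    refine Finset.sum_congr rfl fun i _ => ?_
    have h := horth i _ (map_mem_eigenGT (hAb i))
    have h' := horth i _ (hAb i)
    rw [map_sub, LinearMap.sub_apply, map_smul, LinearMap.smul_apply, hb, if_pos rfl] at h'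
    rw [map_sub, map_sub, LinearMap.sub_apply, map_smul, map_smul, LinearMap.smul_apply,
      sub_eq_zero.mp h', smul_eq_mul, smul_eq_mul, mul_one] at h
    rw [LinearMap.comp_apply, pow_two]
    exact sub_eq_zero.mp h
  have htradA : ∀ x, LinearMap.trace ℝ g (LieAlgebra.ad ℝ g x ∘ₗ A)
      = ∑ i, w i * ip ⁅x, b i⁆ (b i) := by
    intro x
    rw [trace_of_orthonormal hb]
    refine Finset.sum_congr rfl fun i _ => ?_
    have h := horth i _ (had_GT x _ (hw0 i) _ (hAb i))
    rw [lie_sub, lie_smul, map_sub, LinearMap.sub_apply, map_smul, LinearMap.smul_apply,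
      smul_eq_mul] at h
    exact sub_eq_zero.mp h
  refine ⟨b, w, hb, hw0, fun i hi => ?_, fun i j k h => ?_, fun x y k hk => ?_, ?_, fun x => ?_⟩
  · refine (eigenGE_le (P := N.toSubmodule) fun μ hμ x hx => ?_) (hbw i)
    obtain ⟨u, rfl, -⟩ := hlift μ (hi.trans_le hμ).ne' x hx
    exact hιN u
  · by_contra hlt
    exact h (horth k _ (eigenGE_le_eigenGT (not_le.mp hlt) (hlie _ _ _ _ (hbw i) (hbw j))))
  · exact horth k _ (hk ▸ hNGT _ (hN x y))
  · rw [← htrA, ← htrAA]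
    have h1 : A ∘ₗ A = ι ∘ₗ (φ.toLinearMap ∘ₗ φ.toLinearMap) ∘ₗ π :=
      LinearMap.ext fun x => hAι _
    rw [h1, htr, htr, hφ.trace_comp]
  · obtain ⟨ψ, hψ⟩ := exists_lieDerivation_of_ideal N e x
    have h1 : LieAlgebra.ad ℝ g x ∘ₗ A = ι ∘ₗ (ψ.toLinearMap ∘ₗ φ.toLinearMap) ∘ₗ π :=
      LinearMap.ext fun y => by
        change ⁅x, ι (φ (π y))⁆ = ι (ψ (φ (π y)))
        rw [hι, hι, hψ]
    have h2 : LieAlgebra.ad ℝ g x = ι ∘ₗ (π ∘ₗ LieAlgebra.ad ℝ g x) := by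
      refine LinearMap.ext fun y => ?_
      obtain ⟨u, hu⟩ := hιsurj _ (hN x y)
      change ⁅x, y⁆ = ι (π ⁅x, y⁆)
      rw [← hu, hπι]
    have h3 : (π ∘ₗ LieAlgebra.ad ℝ g x) ∘ₗ ι = ψ.toLinearMap := by
      refine LinearMap.ext fun u => ?_
      change π ⁅x, ι u⁆ = ψ u
      rw [hι, ← hψ, ← hι, hπι]
    rw [← htradA, h1, htr, LinearMap.trace_comp_comm',
      hφ.trace_comp]
    conv_rhs => rw [h2, LinearMap.trace_comp_comm', h3]

end Adapted

/-! ### The Ricci tensor of a left-invariant metric -/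

section Ricci

open Module Finset

variable {L : Type*} [LieRing L] [LieAlgebra ℝ L]
  {ip : LinearMap.BilinForm ℝ L}
  {D : L →ₗ[ℝ] L →ₗ[ℝ] L} {ι : Type*} [Fintype ι] [DecidableEq ι] {b : Basis ι ℝ L}

/-- The Koszul formula. -/
theorem IsLeviCivita.koszul (hip : IsInnerProduct ip) (hD : IsLeviCivita ip D) (X Y Z : L) :
    ip (D X Y) Z = (1 / 2) * (ip ⁅X, Y⁆ Z - ip ⁅Y, Z⁆ X - ip ⁅X, Z⁆ Y) := by
  rw [← hD.torsion_free X Y, ← hD.torsion_free Y Z, ← hD.torsion_free X Z]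
  simp only [map_sub, LinearMap.sub_apply]
  have h1 := hD.metric X Y Z
  have h2 := hD.metric Y X Z
  have h3 := hD.metric Z X Y
  rw [hip.symm Y] at h1
  rw [hip.symm X] at h2
  rw [hip.symm X] at h3
  linarith

/-- The Ricci tensor in terms of the traces of the operators `D X` and `ad X`; here `H` is the
mean curvature vector, defined by `ip H X = Tr (ad X)`. -/
theorem IsLeviCivita.ricciTensor_self (hip : IsInnerProduct ip)
    (hD : IsLeviCivita ip D) (hb : ∀ i j, ip (b i) (b j) = if i = j then 1 else 0) {H : L}
    (hH : ∀ X, LinearMap.trace ℝ L (LieAlgebra.ad ℝ L X) = ip H X) (Y : L) :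
    ricciTensor D Y Y = -ip H (D Y Y) - LinearMap.trace ℝ L (D Y ∘ₗ D Y)
      + 2 * LinearMap.trace ℝ L (D Y ∘ₗ LieAlgebra.ad ℝ L Y)
      - LinearMap.trace ℝ L (LieAlgebra.ad ℝ L Y ∘ₗ LieAlgebra.ad ℝ L Y) := by
  have h1 : LinearMap.trace ℝ L (D.flip (D Y Y)) = -ip H (D Y Y) := by
    rw [← hH, trace_of_orthonormal hb, trace_of_orthonormal hb, ← sum_neg_distrib]
    refine sum_congr rfl fun i _ => ?_
    change ip (D (b i) (D Y Y)) (b i) = -ip ⁅D Y Y, b i⁆ (b i)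
    rw [hD.koszul hip, ← lie_skew (b i) (D Y Y)]
    simp only [lie_self, map_neg, LinearMap.neg_apply, map_zero, LinearMap.zero_apply]
    ring
  have h2 : curvature D Y Y = D.flip (D Y Y) - D Y ∘ₗ D Y + D Y ∘ₗ LieAlgebra.ad ℝ L Y
      + D Y ∘ₗ LieAlgebra.ad ℝ L Y - LieAlgebra.ad ℝ L Y ∘ₗ LieAlgebra.ad ℝ L Y := by
    have ht : ∀ X, D X Y = D Y X - ⁅Y, X⁆ := fun X => by
      rw [← hD.torsion_free Y X]; abel
    refine LinearMap.ext fun X => ?_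
    change D X (D Y Y) - D Y (D X Y) - D ⁅X, Y⁆ Y = D X (D Y Y) - D Y (D Y X) + D Y ⁅Y, X⁆
      + D Y ⁅Y, X⁆ - ⁅Y, ⁅Y, X⁆⁆
    rw [ht X, ht ⁅X, Y⁆, ← lie_skew X Y]
    simp only [map_neg, map_sub, lie_neg]
    abel
  rw [ricciTensor, h2]
  simp only [map_sub, map_add, h1]
  ring

/-- The Ricci curvature of a left-invariant metric in an orthonormal basis. -/
theorem IsLeviCivita.ricciTensor_self_eq_sum [FiniteDimensional ℝ L] (hip : IsInnerProduct ip)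
    (hD : IsLeviCivita ip D) (hb : ∀ i j, ip (b i) (b j) = if i = j then 1 else 0) {H : L}
    (hH : ∀ X, LinearMap.trace ℝ L (LieAlgebra.ad ℝ L X) = ip H X) (Y : L) :
    ricciTensor D Y Y = -(1 / 2) * ∑ i, ip ⁅Y, b i⁆ ⁅Y, b i⁆
      - (1 / 2) * LinearMap.trace ℝ L (LieAlgebra.ad ℝ L Y ∘ₗ LieAlgebra.ad ℝ L Y)
      + (1 / 4) * ∑ i, ∑ j, ip ⁅b i, b j⁆ Y * ip ⁅b i, b j⁆ Y - ip ⁅H, Y⁆ Y := by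
  rw [hD.ricciTensor_self hip hb hH, trace_comp_of_orthonormal hb,
    trace_comp_of_orthonormal hb, trace_comp_of_orthonormal hb]
  have hHY : ip H (D Y Y) = ip ⁅H, Y⁆ Y := by
    rw [hip.symm, hD.koszul hip, lie_self, ← lie_skew H Y]
    simp only [map_neg, LinearMap.neg_apply, map_zero, LinearMap.zero_apply]
    ring
  -- `a i j` is the matrix of `ad Y`, and `c i j` that of a skew-symmetric operator
  set a : ι → ι → ℝ := fun i j => ip ⁅Y, b i⁆ (b j) with ha
  set c : ι → ι → ℝ := fun i j => ip ⁅b i, b j⁆ Y with hc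
  have hcskew : ∀ i j, c i j = -c j i := fun i j => by
    simp only [hc]
    rw [← lie_skew, map_neg, LinearMap.neg_apply]
  have hDa : ∀ i j, ip (D Y (b i)) (b j) = (1 / 2) * (a i j - a j i - c i j) := fun i j => by
    rw [hD.koszul hip]
    simp only [ha, hc]
    ring
  have hsq : ∀ i, ip ⁅Y, b i⁆ ⁅Y, b i⁆ = ∑ j, a i j * a i j := fun i =>
    (sum_mul_of_orthonormal hb _ _).symm
  simp only [hDa, LieAlgebra.ad_apply, hsq, hHY]
  change -ip ⁅H, Y⁆ Y - ∑ i, ∑ j, 1 / 2 * (a i j - a j i - c i j) * (1 / 2 * (a j i - a i j - c j i))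
    + 2 * ∑ i, ∑ j, 1 / 2 * (a i j - a j i - c i j) * a j i - ∑ i, ∑ j, a i j * a j i
    = -(1 / 2) * ∑ i, ∑ j, a i j * a i j - 1 / 2 * ∑ i, ∑ j, a i j * a j i
      + 1 / 4 * ∑ i, ∑ j, c i j * c i j - ip ⁅H, Y⁆ Y
  have e1 : ∑ i, ∑ j, a j i * a j i = ∑ i, ∑ j, a i j * a i j := sum_comm
  have e2 : ∑ i, ∑ j, c i j * a j i = -∑ i, ∑ j, c i j * a i j := by
    rw [sum_comm, ← sum_neg_distrib]
    refine sum_congr rfl fun i _ => ?_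
    rw [← sum_neg_distrib]
    exact sum_congr rfl fun j _ => by rw [hcskew j i]; ring
  have e3 : ∀ i j, 1 / 2 * (a i j - a j i - c i j) * (1 / 2 * (a j i - a i j - c j i))
      = (1 / 2) * (a i j * a j i) - (1 / 4) * (a i j * a i j) - (1 / 4) * (a j i * a j i)
        + (1 / 2) * (c i j * a i j) - (1 / 2) * (c i j * a j i) - (1 / 4) * (c i j * c i j) := by
    intro i j
    rw [hcskew j i]
    ring
  have e4 : ∀ i j, 1 / 2 * (a i j - a j i - c i j) * a j i
      = (1 / 2) * (a i j * a j i) - (1 / 2) * (a j i * a j i) - (1 / 2) * (c i j * a j i) := by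
    intro i j
    ring
  simp only [e3, e4, sum_add_distrib, sum_sub_distrib, ← mul_sum, e1, e2]
  ring

/-- The Einstein equation `Ric = c ip` in an orthonormal basis. -/
theorem IsLeviCivita.einstein_eq_sum [FiniteDimensional ℝ L] (hip : IsInnerProduct ip)
    (hD : IsLeviCivita ip D) (hb : ∀ i j, ip (b i) (b j) = if i = j then 1 else 0) {H : L}
    (hH : ∀ X, LinearMap.trace ℝ L (LieAlgebra.ad ℝ L X) = ip H X) {c : ℝ}
    (hc : ∀ Y Z, ricciTensor D Y Z = c * ip Y Z) (Y Z : L) :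
    c * ip Y Z = -(1 / 2) * ∑ i, ip ⁅Y, b i⁆ ⁅Z, b i⁆
      - (1 / 2) * LinearMap.trace ℝ L (LieAlgebra.ad ℝ L Z ∘ₗ LieAlgebra.ad ℝ L Y)
      + (1 / 4) * ∑ i, ∑ j, ip ⁅b i, b j⁆ Y * ip ⁅b i, b j⁆ Z
      - (1 / 2) * (ip ⁅H, Y⁆ Z + ip ⁅H, Z⁆ Y) := by
  have h1 := hD.ricciTensor_self_eq_sum hip hb hH Y
  have h2 := hD.ricciTensor_self_eq_sum hip hb hH Z
  have h3 := hD.ricciTensor_self_eq_sum hip hb hH (Y + Z)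
  rw [hc] at h1 h2 h3
  have e1 : ∑ i, ip ⁅Y + Z, b i⁆ ⁅Y + Z, b i⁆ = ∑ i, ip ⁅Y, b i⁆ ⁅Y, b i⁆
      + ∑ i, ip ⁅Z, b i⁆ ⁅Z, b i⁆ + 2 * ∑ i, ip ⁅Y, b i⁆ ⁅Z, b i⁆ := by
    rw [mul_sum, ← sum_add_distrib, ← sum_add_distrib]
    refine sum_congr rfl fun i _ => ?_
    simp only [add_lie, map_add, LinearMap.add_apply, hip.symm ⁅Z, b i⁆ ⁅Y, b i⁆]
    ring
  have e2 : ∑ i, ∑ j, ip ⁅b i, b j⁆ (Y + Z) * ip ⁅b i, b j⁆ (Y + Z)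
      = ∑ i, ∑ j, ip ⁅b i, b j⁆ Y * ip ⁅b i, b j⁆ Y
        + ∑ i, ∑ j, ip ⁅b i, b j⁆ Z * ip ⁅b i, b j⁆ Z
        + 2 * ∑ i, ∑ j, ip ⁅b i, b j⁆ Y * ip ⁅b i, b j⁆ Z := by
    simp only [mul_sum, ← sum_add_distrib]
    refine sum_congr rfl fun i _ => sum_congr rfl fun j _ => ?_
    simp only [map_add]
    ring
  have e3 : LinearMap.trace ℝ L (LieAlgebra.ad ℝ L (Y + Z) ∘ₗ LieAlgebra.ad ℝ L (Y + Z))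
      = LinearMap.trace ℝ L (LieAlgebra.ad ℝ L Y ∘ₗ LieAlgebra.ad ℝ L Y)
        + LinearMap.trace ℝ L (LieAlgebra.ad ℝ L Z ∘ₗ LieAlgebra.ad ℝ L Z)
        + 2 * LinearMap.trace ℝ L (LieAlgebra.ad ℝ L Z ∘ₗ LieAlgebra.ad ℝ L Y) := by
    simp only [map_add, LinearMap.add_comp, LinearMap.comp_add,
      LinearMap.trace_comp_comm' (LieAlgebra.ad ℝ L Y) (LieAlgebra.ad ℝ L Z)]
    ring
  rw [e1, e2, e3] at h3
  simp only [map_add, lie_add, LinearMap.add_apply, hip.symm Z Y] at h3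
  linarith

end Ricci

/-! ### Einstein metrics and adapted bases -/

section Einstein

open Module Finset

variable {L : Type*} [LieRing L] [LieAlgebra ℝ L]
  {ip : LinearMap.BilinForm ℝ L} {D : L →ₗ[ℝ] L →ₗ[ℝ] L} {ι : Type*} [Fintype ι] [DecidableEq ι]
  {b : Basis ι ℝ L} {w : ι → ℝ} {N : LieIdeal ℝ L} {H : L} {c : ℝ}

/-- The matrix of the symmetric part of `ad x` in the basis `b`. -/
noncomputable def symmAd {L ι : Type*} [LieRing L] [LieAlgebra ℝ L] (ip : LinearMap.BilinForm ℝ L)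
    (b : ι → L) (x : L) (k l : ι) : ℝ :=
  (1 / 2) * (ip ⁅x, b k⁆ (b l) + ip ⁅x, b l⁆ (b k))

/-- The pairing `Tr (R ∘ E)` of the operator `E` of the weights `w` with the moment map part `R` of
the Ricci tensor: the structure constants of the Lie bracket, each contributing its weight. -/
noncomputable def weightEnergy {L ι : Type*} [LieRing L] [LieAlgebra ℝ L] [Fintype ι]
    (ip : LinearMap.BilinForm ℝ L) (b : ι → L) (w : ι → ℝ) : ℝ :=
  (1 / 4) * ∑ i, ∑ j, ∑ k, (w k - w i - w j) * ip ⁅b i, b j⁆ (b k) ^ 2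

theorem lie_eq_sum_of_orthonormal (hb : ∀ i j, ip (b i) (b j) = if i = j then 1 else 0) (x y : L) :
    ⁅x, y⁆ = ∑ k, ip y (b k) • ⁅x, b k⁆ := by
  conv_lhs => rw [← sum_smul_of_orthonormal hb y]
  simp only [lie_sum, lie_smul]

theorem sum_symmAd_sq [FiniteDimensional ℝ L]
    (hb : ∀ i j, ip (b i) (b j) = if i = j then 1 else 0) (x : L) :
    ∑ k, ∑ l, symmAd ip b x k l ^ 2 = (1 / 2) * ∑ i, ip ⁅x, b i⁆ ⁅x, b i⁆
      + (1 / 2) * LinearMap.trace ℝ L (LieAlgebra.ad ℝ L x ∘ₗ LieAlgebra.ad ℝ L x) := by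
  rw [trace_comp_of_orthonormal hb]
  simp only [← sum_mul_of_orthonormal hb ⁅x, b _⁆ ⁅x, b _⁆, LieAlgebra.ad_apply]
  have h : ∀ k l, symmAd ip b x k l ^ 2 = (1 / 4) * (ip ⁅x, b k⁆ (b l) * ip ⁅x, b k⁆ (b l))
      + (1 / 4) * (ip ⁅x, b l⁆ (b k) * ip ⁅x, b l⁆ (b k))
      + (1 / 2) * (ip ⁅x, b k⁆ (b l) * ip ⁅x, b l⁆ (b k)) := fun k l => by
    rw [symmAd]; ring
  simp only [h, sum_add_distrib, ← mul_sum]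
  rw [sum_comm (f := fun k l => ip ⁅x, b l⁆ (b k) * ip ⁅x, b l⁆ (b k))]
  ring

/-- The Einstein equation evaluated on a vector orthogonal to the derived algebra. -/
theorem IsLeviCivita.einstein_of_orthogonal [FiniteDimensional ℝ L] (hip : IsInnerProduct ip)
    (hD : IsLeviCivita ip D)
    (hb : ∀ i j, ip (b i) (b j) = if i = j then 1 else 0)
    (hH : ∀ X, LinearMap.trace ℝ L (LieAlgebra.ad ℝ L X) = ip H X)
    (hc : ∀ Y Z, ricciTensor D Y Z = c * ip Y Z) {x : L} (hx : ∀ u v : L, ip ⁅u, v⁆ x = 0) :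
    c * ip x x = -∑ k, ∑ l, symmAd ip b x k l ^ 2 := by
  rw [hD.einstein_eq_sum hip hb hH hc, sum_symmAd_sq hb]
  simp only [hx, mul_zero, sum_const_zero]
  ring

/-- The trace of the Einstein equation against `ad H`. The moment map part of the Ricci tensor is
orthogonal to derivations, hence does not contribute. -/
theorem IsLeviCivita.sum_symmAd_meanCurvature [FiniteDimensional ℝ L] (hip : IsInnerProduct ip)
    (hD : IsLeviCivita ip D)
    (hb : ∀ i j, ip (b i) (b j) = if i = j then 1 else 0)
    (hH : ∀ X, LinearMap.trace ℝ L (LieAlgebra.ad ℝ L X) = ip H X)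
    (hc : ∀ Y Z, ricciTensor D Y Z = c * ip Y Z)
    (hN : ∀ x y z : L, LinearMap.trace ℝ L (LieAlgebra.ad ℝ L x ∘ₗ LieAlgebra.ad ℝ L ⁅y, z⁆) = 0) :
    ∑ k, ∑ l, symmAd ip b H k l ^ 2 = -c * ip H H := by
  have h0 : ∀ k, c * ip ⁅H, b k⁆ (b k) = -(1 / 2) * ∑ i, ip ⁅⁅H, b k⁆, b i⁆ ⁅b k, b i⁆
      + (1 / 4) * ∑ i, ∑ j, ip ⁅b i, b j⁆ ⁅H, b k⁆ * ip ⁅b i, b j⁆ (b k)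
      - (1 / 2) * (ip ⁅H, ⁅H, b k⁆⁆ (b k) + ip ⁅H, b k⁆ ⁅H, b k⁆) := fun k => by
    have h := hD.einstein_eq_sum hip hb hH hc ⁅H, b k⁆ (b k)
    rw [hN] at h
    linarith
  have h1 := sum_congr rfl fun k (_ : k ∈ univ) => h0 k
  simp only [sum_add_distrib, sum_sub_distrib, ← mul_sum] at h1
  have htr : ∑ k, ip ⁅H, b k⁆ (b k) = ip H H := by
    rw [← hH, trace_of_orthonormal hb]; rfl
  have htr2 : ∑ k, ip ⁅H, ⁅H, b k⁆⁆ (b k)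
      = LinearMap.trace ℝ L (LieAlgebra.ad ℝ L H ∘ₗ LieAlgebra.ad ℝ L H) := by
    rw [trace_of_orthonormal hb]; rfl
  have hT2 : ∑ k, ∑ i, ∑ j, ip ⁅b i, b j⁆ ⁅H, b k⁆ * ip ⁅b i, b j⁆ (b k)
      = ∑ i, ∑ j, ip ⁅b i, b j⁆ ⁅H, ⁅b i, b j⁆⁆ := by
    rw [sum_comm]
    refine sum_congr rfl fun i _ => ?_
    rw [sum_comm]
    refine sum_congr rfl fun j _ => ?_
    rw [lie_eq_sum_of_orthonormal hb H ⁅b i, b j⁆]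
    simp only [map_sum, map_smul, smul_eq_mul, mul_comm]
  -- by the Jacobi identity, the contributions of `R` cancel
  have hT : ∑ i, ∑ j, ip ⁅b i, b j⁆ ⁅H, ⁅b i, b j⁆⁆
      = 2 * ∑ k, ∑ i, ip ⁅⁅H, b k⁆, b i⁆ ⁅b k, b i⁆ := by
    have h2 : ∀ i j, ip ⁅b i, b j⁆ ⁅H, ⁅b i, b j⁆⁆ = ip ⁅⁅H, b i⁆, b j⁆ ⁅b i, b j⁆
        + ip ⁅⁅H, b j⁆, b i⁆ ⁅b j, b i⁆ := fun i j => by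
      rw [leibniz_lie, map_add, hip.symm ⁅b i, b j⁆, hip.symm ⁅b i, b j⁆,
        ← lie_skew (b i) ⁅H, b j⁆, ← lie_skew (b i) (b j)]
      simp only [map_neg, LinearMap.neg_apply, neg_neg]
    simp only [h2, sum_add_distrib]
    rw [sum_comm (f := fun i j => ip ⁅⁅H, b j⁆, b i⁆ ⁅b j, b i⁆)]
    ring
  rw [htr, htr2, hT2, hT] at h1
  rw [sum_symmAd_sq hb]
  linarith

namespace IsAdaptedBasis

theorem weightEnergy_term_nonneg (hA : IsAdaptedBasis ip N b w) (i j k : ι) :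
    0 ≤ (w k - w i - w j) * ip ⁅b i, b j⁆ (b k) ^ 2 := by
  by_cases h : ip ⁅b i, b j⁆ (b k) = 0
  · simp [h]
  · have := hA.add_le i j k h
    exact mul_nonneg (by linarith) (sq_nonneg _)

theorem weightEnergy_nonneg (hA : IsAdaptedBasis ip N b w) : 0 ≤ weightEnergy ip b w :=
  mul_nonneg (by norm_num) (sum_nonneg fun i _ => sum_nonneg fun j _ => sum_nonneg
    fun k _ => hA.weightEnergy_term_nonneg i j k)

/-- If the weight energy vanishes, then the basis vectors of weight zero commute: the components of
their brackets would contribute with positive weight. -/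
theorem lie_basis_eq_zero (hA : IsAdaptedBasis ip N b w) (hP : weightEnergy ip b w = 0) {i j : ι}
    (hi : w i = 0) (hj : w j = 0) : ⁅b i, b j⁆ = 0 := by
  have hterm := hA.weightEnergy_term_nonneg
  have h1 := (mul_eq_zero.mp hP).resolve_left (by norm_num)
  rw [sum_eq_zero_iff_of_nonneg fun i _ => sum_nonneg fun j _ => sum_nonneg
    fun k _ => hterm i j k] at h1
  have h2 := h1 i (mem_univ i)
  rw [sum_eq_zero_iff_of_nonneg fun j _ => sum_nonneg fun k _ => hterm i j k] at h2
  have h3 := h2 j (mem_univ j)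
  rw [sum_eq_zero_iff_of_nonneg fun k _ => hterm i j k] at h3
  rw [← sum_smul_of_orthonormal hA.orthonormal ⁅b i, b j⁆]
  refine sum_eq_zero fun k hk => ?_
  suffices h : ip ⁅b i, b j⁆ (b k) = 0 by rw [h, zero_smul]
  by_cases hwk : w k = 0
  · exact hA.lie_of_eq_zero _ _ k hwk
  · have h4 := h3 k hk
    rw [hi, hj, sub_zero, sub_zero] at h4
    exact pow_eq_zero_iff two_ne_zero |>.mp ((mul_eq_zero.mp h4).resolve_left hwk)

theorem lie_eq_zero_of_apply_eq_zero (hA : IsAdaptedBasis ip N b w)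
    (hP : weightEnergy ip b w = 0) {x y : L} (hx : ∀ k, w k ≠ 0 → ip x (b k) = 0)
    (hy : ∀ k, w k ≠ 0 → ip y (b k) = 0) : ⁅x, y⁆ = 0 := by
  rw [← sum_smul_of_orthonormal hA.orthonormal x, ← sum_smul_of_orthonormal hA.orthonormal y]
  simp only [sum_lie, lie_sum, smul_lie, lie_smul, smul_sum]
  refine sum_eq_zero fun j _ => sum_eq_zero fun i _ => ?_
  by_cases hi : w i = 0
  · by_cases hj : w j = 0
    · rw [hA.lie_basis_eq_zero hP hi hj, smul_zero, smul_zero]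
    · rw [hy j hj, zero_smul]
  · rw [hx i hi, zero_smul, smul_zero]

/-- The trace of the Einstein equation against the operator of the weights. -/
theorem einstein_mul_sum [FiniteDimensional ℝ L] [LieRing.IsNilpotent N]
    (hA : IsAdaptedBasis ip N b w) (hip : IsInnerProduct ip) (hD : IsLeviCivita ip D)
    (hH : ∀ X, LinearMap.trace ℝ L (LieAlgebra.ad ℝ L X) = ip H X)
    (hc : ∀ Y Z, ricciTensor D Y Z = c * ip Y Z) :
    c * ∑ k, w k = weightEnergy ip b w - ip H H := by
  have hb := hA.orthonormal
  have h0 : ∀ k, c * w k = -(1 / 2) * ∑ i, ∑ l, w k * ip ⁅b k, b i⁆ (b l) ^ 2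
      + (1 / 4) * ∑ i, ∑ j, w k * ip ⁅b i, b j⁆ (b k) ^ 2 - w k * ip ⁅H, b k⁆ (b k) := by
    intro k
    have h := hD.einstein_eq_sum hip hb hH hc (b k) (b k)
    have hK : w k * LinearMap.trace ℝ L (LieAlgebra.ad ℝ L (b k) ∘ₗ LieAlgebra.ad ℝ L (b k))
        = 0 := by
      rcases (hA.nonneg k).eq_or_lt with h0 | hpos
      · rw [← h0, zero_mul]
      · rw [N.trace_ad_comp_ad_eq_zero _ (hA.mem_of_pos k hpos), mul_zero]
    rw [hb, if_pos rfl, mul_one] at h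
    simp only [← sum_mul_of_orthonormal hb ⁅b k, b _⁆ ⁅b k, b _⁆] at h
    simp only [← mul_sum, pow_two]
    rw [h]
    linear_combination (-1 / 2) * hK
  have h1 := sum_congr rfl fun k (_ : k ∈ univ) => h0 k
  simp only [sum_add_distrib, sum_sub_distrib, ← mul_sum] at h1
  rw [hA.sum_ad, hH] at h1
  have e1 : ∑ k, w k * ∑ i, ∑ l, ip ⁅b k, b i⁆ (b l) ^ 2
      = ∑ i, ∑ j, ∑ k, w i * ip ⁅b i, b j⁆ (b k) ^ 2 := by simp only [mul_sum]
  have e2 : ∑ i, ∑ j, ∑ k, w j * ip ⁅b i, b j⁆ (b k) ^ 2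
      = ∑ i, ∑ j, ∑ k, w i * ip ⁅b i, b j⁆ (b k) ^ 2 := by
    rw [sum_comm]
    refine sum_congr rfl fun i _ => sum_congr rfl fun j _ => sum_congr rfl fun k _ => ?_
    rw [← lie_skew, map_neg, LinearMap.neg_apply, neg_sq]
  have e3 : ∑ k, w k * ∑ i, ∑ j, ip ⁅b i, b j⁆ (b k) ^ 2
      = ∑ i, ∑ j, ∑ k, w k * ip ⁅b i, b j⁆ (b k) ^ 2 := by
    simp only [mul_sum]
    rw [sum_comm]
    exact sum_congr rfl fun i _ => sum_comm
  rw [e1, e3] at h1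
  rw [weightEnergy, h1]
  simp only [sub_mul, sum_sub_distrib, e2]
  ring

/-- If `H ≠ 0`, then the weight energy vanishes, and the symmetric part of `ad H` is proportional to
the operator of the weights. This is the equality case of the Cauchy-Schwarz inequality between
these two operators: the traces of their squares and of their product are known, and
`einstein_mul_sum` says that the inequality can only hold with equality. -/
theorem symmAd_meanCurvature [FiniteDimensional ℝ L] [LieRing.IsNilpotent N]
    (hA : IsAdaptedBasis ip N b w) (hip : IsInnerProduct ip) (hD : IsLeviCivita ip D)
    (hH : ∀ X, LinearMap.trace ℝ L (LieAlgebra.ad ℝ L X) = ip H X)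
    (hc : ∀ Y Z, ricciTensor D Y Z = c * ip Y Z) (hN : ∀ x y : L, ⁅x, y⁆ ∈ N)
    (hH0 : 0 < ip H H) :
    weightEnergy ip b w = 0 ∧
      ∀ k l, (∑ i, w i) * symmAd ip b H k l = ip H H * if k = l then w k else 0 := by
  have hE := hA.einstein_mul_sum hip hD hH hc
  have hS := hD.sum_symmAd_meanCurvature hip hA.orthonormal hH hc fun x y z =>
    N.trace_ad_comp_ad_eq_zero x (hN y z)
  have hsE : ∑ k, w k * symmAd ip b H k k = ip H H := by
    rw [← hH H, ← hA.sum_ad]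
    refine sum_congr rfl fun k _ => ?_
    rw [symmAd]
    ring
  have hP := hA.weightEnergy_nonneg
  set W := ∑ i, w i with hW
  have hWpos : 0 < W := by
    refine (sum_nonneg fun i _ => hA.nonneg i).lt_of_ne fun h0 => hH0.ne' ?_
    have h1 := (sum_eq_zero_iff_of_nonneg fun i _ => hA.nonneg i).mp h0.symm
    rw [← hsE]
    exact sum_eq_zero fun k hk => by rw [h1 k hk, zero_mul]
  -- the defect in the Cauchy-Schwarz inequality is a nonpositive multiple of the weight energy
  have hsum : ∑ k, ∑ l, (W * symmAd ip b H k l - ip H H * if k = l then w k else 0) ^ 2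
      = -(W * ip H H * weightEnergy ip b w) := by
    have h1 : ∀ k l, (W * symmAd ip b H k l - ip H H * if k = l then w k else 0) ^ 2
        = W ^ 2 * symmAd ip b H k l ^ 2
          - 2 * W * ip H H * (if k = l then w k * symmAd ip b H k l else 0)
          + ip H H ^ 2 * (if k = l then w k ^ 2 else 0) := by
      intro k l
      split_ifs <;> ring
    simp only [h1, sum_add_distrib, sum_sub_distrib, ← mul_sum, sum_ite_eq, mem_univ, if_true,
      hS, hsE, hA.sum_sq]
    rw [← hW]
    linear_combination (-W * ip H H) * hE
  have hnonneg : ∀ k l, 0 ≤ (W * symmAd ip b H k l - ip H H * if k = l then w k else 0) ^ 2 :=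
    fun k l => sq_nonneg _
  have hmul : 0 ≤ W * ip H H * weightEnergy ip b w := by positivity
  have hzero := le_antisymm (hsum.trans_le (neg_nonpos.mpr hmul))
    (sum_nonneg fun k _ => sum_nonneg fun l _ => hnonneg k l)
  refine ⟨?_, fun k l => ?_⟩
  · rw [hsum, neg_eq_zero] at hzero
    exact (mul_eq_zero.mp hzero).resolve_left (mul_pos hWpos hH0).ne'
  · have h1 := (sum_eq_zero_iff_of_nonneg fun k _ => sum_nonneg fun l _ => hnonneg k l).mp hzero k
      (mem_univ k)
    have h2 := (sum_eq_zero_iff_of_nonneg fun l _ => hnonneg k l).mp h1 l (mem_univ l)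
    exact sub_eq_zero.mp (pow_eq_zero_iff two_ne_zero |>.mp h2)

/-- If `H ≠ 0`, the symmetric part of `ad H` is a positive multiple of the operator of the weights, and
`ip ⁅H, x⁆ x = 0` forces a vector `x` orthogonal to the derived algebra to have weight zero. -/
theorem lie_eq_zero_of_meanCurvature_ne_zero [FiniteDimensional ℝ L] [LieRing.IsNilpotent N]
    (hA : IsAdaptedBasis ip N b w) (hip : IsInnerProduct ip) (hD : IsLeviCivita ip D)
    (hH : ∀ X, LinearMap.trace ℝ L (LieAlgebra.ad ℝ L X) = ip H X)
    (hc : ∀ Y Z, ricciTensor D Y Z = c * ip Y Z) (hN : ∀ x y : L, ⁅x, y⁆ ∈ N)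
    (hH0 : 0 < ip H H) {x y : L} (hx : ∀ u v : L, ip ⁅u, v⁆ x = 0)
    (hy : ∀ u v : L, ip ⁅u, v⁆ y = 0) : ⁅x, y⁆ = 0 := by
  have hb := hA.orthonormal
  obtain ⟨hP, hs⟩ := hA.symmAd_meanCurvature hip hD hH hc hN hH0
  -- the symmetric part of `ad H` is positive on the span of the vectors of positive weight
  have key : ∀ x : L, (∀ u v : L, ip ⁅u, v⁆ x = 0) → ∀ k, w k ≠ 0 → ip x (b k) = 0 := by
    intro x hx k hk
    have h1 : ∑ k, ∑ l, ip x (b k) * ip x (b l) * ip ⁅H, b k⁆ (b l) = 0 := by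
      rw [← hx H x, lie_eq_sum_of_orthonormal hb H x, map_sum, LinearMap.sum_apply]
      refine sum_congr rfl fun k _ => ?_
      rw [map_smul, LinearMap.smul_apply, smul_eq_mul, ← sum_mul_of_orthonormal hb _ x, mul_sum]
      exact sum_congr rfl fun l _ => by ring
    have h2 : ∑ k, ∑ l, ip x (b k) * ip x (b l) * symmAd ip b H k l = 0 := by
      have h3 : ∀ k l, ip x (b k) * ip x (b l) * symmAd ip b H k l
          = (1 / 2) * (ip x (b k) * ip x (b l) * ip ⁅H, b k⁆ (b l))
            + (1 / 2) * (ip x (b l) * ip x (b k) * ip ⁅H, b l⁆ (b k)) := fun k l => by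
        rw [symmAd]; ring
      simp only [h3, sum_add_distrib, ← mul_sum]
      rw [sum_comm (f := fun k l => ip x (b l) * ip x (b k) * ip ⁅H, b l⁆ (b k)), h1]
      ring
    have h3 : ∑ k, ip x (b k) ^ 2 * w k = 0 := by
      refine (mul_eq_zero.mp ?_).resolve_left hH0.ne'
      rw [← mul_zero (∑ i, w i), ← h2, mul_sum, mul_sum]
      refine sum_congr rfl fun k _ => ?_
      have h4 : ∀ l, (∑ i, w i) * (ip x (b k) * ip x (b l) * symmAd ip b H k l)
          = if k = l then ip x (b k) * ip x (b l) * (ip H H * w k) else 0 := fun l => by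
        rw [mul_left_comm, hs k l]
        split_ifs <;> ring
      rw [mul_sum, sum_congr rfl fun l _ => h4 l, sum_ite_eq, if_pos (mem_univ k)]
      ring
    have h4 := (sum_eq_zero_iff_of_nonneg fun k _ =>
      mul_nonneg (sq_nonneg _) (hA.nonneg k)).mp h3 k (mem_univ k)
    exact pow_eq_zero_iff two_ne_zero |>.mp ((mul_eq_zero.mp h4).resolve_right hk)
  exact hA.lie_eq_zero_of_apply_eq_zero hP (key x hx) (key y hy)

/-- If `H = 0`, then `c ≤ 0` makes the weight energy vanish, and either all weights are zero or the
metric is Ricci-flat. -/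
theorem lie_eq_zero_of_meanCurvature_eq_zero [FiniteDimensional ℝ L] [LieRing.IsNilpotent N]
    (hA : IsAdaptedBasis ip N b w) (hip : IsInnerProduct ip) (hD : IsLeviCivita ip D)
    (hH : ∀ X, LinearMap.trace ℝ L (LieAlgebra.ad ℝ L X) = ip H X)
    (hc : ∀ Y Z, ricciTensor D Y Z = c * ip Y Z)
    (hH0 : H = 0) {x y : L} (hx : ∀ u v : L, ip ⁅u, v⁆ x = 0)
    (hy : ∀ u v : L, ip ⁅u, v⁆ y = 0) : ⁅x, y⁆ = 0 := by
  have hb := hA.orthonormal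
  rcases eq_or_ne x 0 with rfl | hx0
  · exact zero_lie y
  have hE := hA.einstein_mul_sum hip hD hH hc
  rw [hH0, map_zero, sub_zero] at hE
  have hP := hA.weightEnergy_nonneg
  have hW : 0 ≤ ∑ k, w k := sum_nonneg fun k _ => hA.nonneg k
  have hc0 : c ≤ 0 := by
    have h1 := hD.einstein_of_orthogonal hip hb hH hc hx
    have h2 : 0 ≤ ∑ k, ∑ l, symmAd ip b x k l ^ 2 :=
      sum_nonneg fun k _ => sum_nonneg fun l _ => sq_nonneg _
    have h3 := hip.pos x hx0
    by_contra hlt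
    have := mul_pos (not_le.mp hlt) h3
    linarith
  have hP0 : weightEnergy ip b w = 0 :=
    le_antisymm (hE ▸ mul_nonpos_of_nonpos_of_nonneg hc0 hW) hP
  rw [hP0] at hE
  rcases mul_eq_zero.mp hE with rfl | hW0
  · -- in the Ricci-flat case, the part of positive weight of `x` is central
    have key : ∀ x : L, (∀ u v : L, ip ⁅u, v⁆ x = 0) →
        ∃ z : L, (∀ v : L, ⁅z, v⁆ = 0) ∧ ∀ k, w k ≠ 0 → ip (x - z) (b k) = 0 := by
      intro x hx
      let z := ∑ k, (if w k = 0 then 0 else ip x (b k)) • b k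
      have hzb : ∀ l, ip z (b l) = if w l = 0 then 0 else ip x (b l) := fun l => by
        simp only [z, map_sum, map_smul, LinearMap.sum_apply, LinearMap.smul_apply, hb,
          smul_eq_mul, mul_ite, mul_one, mul_zero, sum_ite_eq', mem_univ, if_true]
      have hzN : z ∈ N := N.sum_mem fun k _ => by
        rcases (hA.nonneg k).eq_or_lt with h0 | hpos
        · rw [if_pos h0.symm, zero_smul]; exact N.zero_mem
        · exact N.smul_mem _ (hA.mem_of_pos k hpos)
      have hz : ∀ u v : L, ip ⁅u, v⁆ z = 0 := by
        intro u v
        rw [← hx u v, ← sum_mul_of_orthonormal hb, ← sum_mul_of_orthonormal hb]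
        refine sum_congr rfl fun k _ => ?_
        rw [hzb]
        split_ifs with h
        · rw [hA.lie_of_eq_zero u v k h, zero_mul, zero_mul]
        · rfl
      refine ⟨z, ?_, fun k hk => by rw [map_sub, LinearMap.sub_apply, hzb, if_neg hk, sub_self]⟩
      have h1 := hD.einstein_of_orthogonal hip hb hH hc hz
      rw [sum_symmAd_sq hb, N.trace_ad_comp_ad_eq_zero z hzN, zero_mul, mul_zero, add_zero,
        eq_comm, neg_eq_zero] at h1
      have hnn : ∀ x, 0 ≤ ip x x := fun x => by
        rcases eq_or_ne x 0 with rfl | h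
        · simp
        · exact (hip.pos x h).le
      have h2 := (sum_eq_zero_iff_of_nonneg fun i _ => hnn _).mp
        ((mul_eq_zero.mp h1).resolve_left (by norm_num))
      have h3 : ∀ i, ⁅z, b i⁆ = 0 := fun i => by
        by_contra hne
        exact (hip.pos _ hne).ne' (h2 i (mem_univ i))
      have h4 : LieAlgebra.ad ℝ L z = 0 := b.ext h3
      exact fun v => LinearMap.congr_fun h4 v
    obtain ⟨z, hz, hxz⟩ := key x hx
    obtain ⟨z', hz', hyz⟩ := key y hy
    have h := hA.lie_eq_zero_of_apply_eq_zero hP0 hxz hyz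
    rwa [sub_lie, lie_sub, hz, ← lie_skew x z', hz', neg_zero, sub_zero, sub_zero] at h
  · have h1 := (sum_eq_zero_iff_of_nonneg fun i _ => hA.nonneg i).mp hW0
    exact hA.lie_eq_zero_of_apply_eq_zero hP0 (fun k hk => absurd (h1 k (mem_univ k)) hk)
      fun k hk => absurd (h1 k (mem_univ k)) hk

end IsAdaptedBasis

end Einstein

/-! ### Standardness -/

open Module in
/-- The mean curvature vector `H` exists: it represents the linear form `X ↦ Tr (ad X)`. -/
theorem exists_meanCurvature {L ι : Type*} [LieRing L] [LieAlgebra ℝ L] [Fintype ι] [DecidableEq ι]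
    {ip : LinearMap.BilinForm ℝ L} (hip : IsInnerProduct ip) {b : Basis ι ℝ L}
    (hb : ∀ i j, ip (b i) (b j) = if i = j then 1 else 0) :
    ∃ H : L, ∀ X, LinearMap.trace ℝ L (LieAlgebra.ad ℝ L X) = ip H X := by
  refine ⟨∑ i, LinearMap.trace ℝ L (LieAlgebra.ad ℝ L (b i)) • b i, fun X => ?_⟩
  conv_lhs => rw [← sum_smul_of_orthonormal hb X]
  simp only [map_sum, map_smul, LinearMap.sum_apply, LinearMap.smul_apply, smul_eq_mul,
    hip.symm X, mul_comm]

/-- The nilradical of a solvable Lie algebra contains all brackets. -/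
theorem IsNilradical.lie_mem {L : Type*} [LieRing L] [LieAlgebra ℝ L] [FiniteDimensional ℝ L]
    [LieAlgebra.IsSolvable L] {N : LieIdeal ℝ L} (hN : IsNilradical N) (x y : L) : ⁅x, y⁆ ∈ N :=
  have hle : LieAlgebra.derivedSeries ℝ L 1 ≤ N := hN.2 LieAlgebra.isNilpotent_derivedSeries_one
  hle (LieSubmodule.lie_mem_lie (LieSubmodule.mem_top x) (LieSubmodule.mem_top y))

theorem theorem1 {n : Type*} [LieRing n] [LieAlgebra ℝ n] [FiniteDimensional ℝ n]
    [LieRing.IsNilpotent n]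
    (φ : LieDerivation ℝ n n) (hφ : IsPreEinstein φ)
    (hpos : IsPosEnd φ.toLinearMap)
    (had : IsNonnegEnd (LieAlgebra.ad ℝ (LieDerivation ℝ n n) φ))
    {g : Type*} [LieRing g] [LieAlgebra ℝ g] [FiniteDimensional ℝ g] [LieAlgebra.IsSolvable g]
    (N : LieIdeal ℝ g) (hN : IsNilradical N) (e : n ≃ₗ⁅ℝ⁆ N)
    (ip : LinearMap.BilinForm ℝ g) (hip : IsInnerProduct ip) (hE : IsEinstein ip) :
    IsStandard ip := by
  obtain ⟨D, hD, c, hc⟩ := hE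
  have : LieRing.IsNilpotent N := hN.1
  obtain ⟨b, w, hA⟩ := exists_isAdaptedBasis hφ hpos had e hN.lie_mem hip
  obtain ⟨H, hH⟩ := exists_meanCurvature hip hA.orthonormal
  have horth : ∀ x ∈ ip.orthogonal
      (⁅(⊤ : LieIdeal ℝ g), (⊤ : LieIdeal ℝ g)⁆ : LieIdeal ℝ g).toSubmodule,
      ∀ u v : g, ip ⁅u, v⁆ x = 0 := fun x hx u v =>
    hx _ (LieSubmodule.lie_mem_lie (LieSubmodule.mem_top u) (LieSubmodule.mem_top v))
  intro x hx y hy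
  rcases eq_or_ne H 0 with hH0 | hH0
  · exact hA.lie_eq_zero_of_meanCurvature_eq_zero hip hD hH hc hH0 (horth x hx) (horth y hy)
  · exact hA.lie_eq_zero_of_meanCurvature_ne_zero hip hD hH hc hN.lie_mem (hip.pos H hH0)
      (horth x hx) (horth y hy)
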